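/- For complex numbers $a,q$ and $m\ge 0$ put $(a;q)_m=\prod_{j=0}^{m-1}(1-aq^j)$ and, for $|q|<1$, $(a;q)_\infty=\prod_{j\ge 0}(1-aq^j)$, $(a_1,a_2,a_3;q)_\infty=(a_1;q)_\infty(a_2;q)_\infty(a_3;q)_\infty$. Then for every complex $q$ with $|q|<1$ (and $q\neq 0$ in the fourth identity, where $q^{-2}$ occurs) the following seven double series converge absolutely and the identities hold: \begin{gather*} \sum_{n,r\ge 0}\frac{q^{4n^2+8nr+6r^2+4n+6r}}{(-q^2;q^2)_{2n+2r+1}(q^2;q^2)_r(-q;q)_{2r+1}(q^4;q^4)_n}=\frac{(q,q^{14},q^{15};q^{15})_\infty}{(q^4;q^4)_\infty},\\ \sum_{n,r\ge 0}\frac{q^{4n^2+8nr+6r^2+4n+6r}}{(-q^2;q^2)_{2n+2r+1}(q^2;q^2)_r(-q;q)_{2r}(q^4;q^4)_n}=\frac{(q^2,q^{13},q^{15};q^{15})_\infty}{(q^4;q^4)_\infty},\\ \sum_{n,r\ge 0}\frac{q^{4n^2+8nr+6r^2+4n+6r}\,(1+q^{2r+1}+2q^{2r+2}+q^{4r+3}+q^{4n+4r+4})}{(-q^2;q^2)_{2n+2r+1}(q^2;q^2)_r(-q;q)_{2r+2}(q^4;q^4)_n}=\frac{(q^3,q^{12},q^{15};q^{15})_\infty}{(q^4;q^4)_\infty},\\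 \sum_{n,r\ge 0}\frac{q^{4n^2+8nr+6r^2-2}\,(q^{4r}+q^{4r+2}+q^{6r+1}+q^{4n+6r+3}-1-q^{2r+1})}{(-q^2;q^2)_{2n+2r}(q^2;q^2)_r(-q;q)_{2r+1}(q^4;q^4)_n}=\frac{(q^4,q^{11},q^{15};q^{15})_\infty}{(q^4;q^4)_\infty},\\ \sum_{n,r\ge 0}\frac{q^{4n^2+8nr+6r^2+2r}\,(1+q^{4n+2r+1})}{(-q^2;q^2)_{2n+2r}(q^2;q^2)_r(-q;q)_{2r+1}(q^4;q^4)_n}=\frac{(q^5;q^5)_\infty}{(q^4;q^4)_\infty},\\ \sum_{n,r\ge 0}\frac{q^{4n^2+8nr+6r^2+2r}}{(-q^2;q^2)_{2n+2r}(q^2;q^2)_r(-q;q)_{2r}(q^4;q^4)_n}=\frac{(q^6,q^9,q^{15};q^{15})_\infty}{(q^4;q^4)_\infty},\\ \sum_{n,r\ge 0}\frac{q^{4n^2+8nr+6r^2}}{(-q^2;q^2)_{2n+2r}(q^2;q^2)_r(-q;q)_{2r}(q^4;q^4)_n}=\frac{(q^7,q^8,q^{15};q^{15})_\infty}{(q^4;q^4)_\infty}.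 \end{gather*} -/

import Mathlib

/-- The finite `q`-shifted factorial `(a;q)_m = ∏_{0 ≤ j < m} (1 - a q^j)`. -/
def qPoch (a q : ℂ) (m : ℕ) : ℂ := ∏ j ∈ Finset.range m, (1 - a * q ^ j)

/-- The infinite `q`-shifted factorial `(a;q)_∞ = ∏_{j ≥ 0} (1 - a q^j)`
(a convergent product whenever `‖q‖ < 1`, see `multipliable_qPochInf`). -/
noncomputable def qPochInf (a q : ℂ) : ℂ := ∏' j : ℕ, (1 - a * q ^ j)

/-- `(a₁, a₂, a₃; q)_∞ = (a₁;q)_∞ (a₂;q)_∞ (a₃;q)_∞`. -/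
noncomputable def qPochInf₃ (a₁ a₂ a₃ q : ℂ) : ℂ :=
  qPochInf a₁ q * qPochInf a₂ q * qPochInf a₃ q

/-- The infinite product defining `(a;q)_∞` converges for `‖q‖ < 1`. -/
theorem multipliable_qPochInf (a : ℂ) {q : ℂ} (hq : ‖q‖ < 1) :
    Multipliable fun j : ℕ => 1 - a * q ^ j := by
  have hs : Summable fun j : ℕ => ‖-(a * q ^ j)‖ := by
    simp only [norm_neg, norm_mul, norm_pow]
    exact (summable_geometric_of_lt_one (norm_nonneg q) hq).mul_left _
  simpa [sub_eq_add_neg] using multipliable_one_add_of_summable hs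

/-!
Everything is an evaluation of double series `∑ q ^ (4 N ^ 2 + A N + 2 r ^ 2 + B r) / (⋯)` in the
variables `N = n + r` and `r`. Recurrences of the Bailey kernel produce Bailey pairs in base `q ^ 2`
whose `α` is a theta term in base `q ^ 3` and whose `β` is a product. The sum over `r` changes the
base of such a pair from `q ^ 2` to `q ^ 4`, and the limiting Bailey transform performs the sum over
`N`. Each of the two steps multiplies `α` by a Gaussian, which raises the base of the theta term to
`q ^ 7` and then to `q ^ 15`, and Jacobi's triple product evaluates the resulting theta series. This
settles the first, second, sixth and seventh identities. Shifted variants of the two steps give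
double series equal to a sum of two theta functions, and contiguous relations between the double
series isolate the single theta function needed in each of the other three.
-/

open Filter Topology

/-! ### `q`-shifted factorials -/

theorem qPoch_succ (a q : ℂ) (m : ℕ) : qPoch a q (m + 1) = qPoch a q m * (1 - a * q ^ m) :=
  Finset.prod_range_succ _ _

@[simp] theorem qPoch_zero (a q : ℂ) : qPoch a q 0 = 1 := rfl

theorem one_sub_ne_zero_of_norm_lt_one {z : ℂ} (hz : ‖z‖ < 1) : 1 - z ≠ 0 := by
  intro h
  rw [← sub_eq_zero.mp h, norm_one] at hz
  exact lt_irrefl _ hz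

theorem norm_pow_lt_one {q : ℂ} (hq : ‖q‖ < 1) {k : ℕ} (hk : k ≠ 0) : ‖q ^ k‖ < 1 := by
  rw [norm_pow]
  exact pow_lt_one₀ (norm_nonneg q) hq hk

theorem norm_zpow_lt_one {q : ℂ} (hq : ‖q‖ < 1) {k : ℤ} (hk : 0 < k) : ‖q ^ k‖ < 1 := by
  lift k to ℕ using hk.le
  exact_mod_cast norm_pow_lt_one hq (by lia : k ≠ 0)

theorem one_sub_zpow_ne_zero {q : ℂ} (hq : ‖q‖ < 1) {k : ℤ} (hk : 0 < k) :
    1 - q ^ k ≠ 0 :=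
  one_sub_ne_zero_of_norm_lt_one (norm_zpow_lt_one hq hk)

theorem one_add_zpow_ne_zero {q : ℂ} (hq : ‖q‖ < 1) {k : ℤ} (hk : 0 < k) :
    1 + q ^ k ≠ 0 := by
  rw [← sub_neg_eq_add]
  exact one_sub_ne_zero_of_norm_lt_one (by rw [norm_neg]; exact norm_zpow_lt_one hq hk)

theorem norm_mul_pow_lt_one {a q : ℂ} (ha : ‖a‖ < 1) (hq : ‖q‖ < 1) (j : ℕ) :
    ‖a * q ^ j‖ < 1 := by
  rw [norm_mul, norm_pow]
  exact mul_lt_one_of_nonneg_of_lt_one_left (norm_nonneg _) ha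
    (pow_le_one₀ (norm_nonneg _) hq.le)

theorem qPoch_ne_zero {a q : ℂ} (ha : ‖a‖ < 1) (hq : ‖q‖ < 1) (m : ℕ) : qPoch a q m ≠ 0 :=
  Finset.prod_ne_zero_iff.mpr fun j _ =>
    one_sub_ne_zero_of_norm_lt_one (norm_mul_pow_lt_one ha hq j)

theorem qPoch_sq_sq (q : ℂ) (m : ℕ) :
    qPoch (q ^ 2) (q ^ 2) m = qPoch q q m * qPoch (-q) q m := by
  rw [qPoch, qPoch, qPoch, ← Finset.prod_mul_distrib]
  exact Finset.prod_congr rfl fun j _ => by ring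

theorem tendsto_qPoch (a : ℂ) {q : ℂ} (hq : ‖q‖ < 1) :
    Tendsto (qPoch a q) atTop (𝓝 (qPochInf a q)) :=
  (multipliable_qPochInf a hq).hasProd.tendsto_prod_nat

theorem qPochInf_ne_zero {a q : ℂ} (ha : ‖a‖ < 1) (hq : ‖q‖ < 1) : qPochInf a q ≠ 0 := by
  have hs : Summable fun j : ℕ => ‖-(a * q ^ j)‖ := by
    simp only [norm_neg, norm_mul, norm_pow]
    exact (summable_geometric_of_lt_one (norm_nonneg q) hq).mul_left _
  simpa only [qPochInf, sub_eq_add_neg] using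
    tprod_one_add_ne_zero_of_summable (f := fun j : ℕ => -(a * q ^ j))
      (fun j => by
        rw [← sub_eq_add_neg]
        exact one_sub_ne_zero_of_norm_lt_one (norm_mul_pow_lt_one ha hq j)) hs

/-- The `q`-shifted factorial `(a;q)_k` at an integer index `k ≥ 0`, so that indices can be
shifted without truncation; the value at `k < 0` is `1`. -/
noncomputable def qPochInt (a q : ℂ) (k : ℤ) : ℂ := qPoch a q k.toNat

/-- The reciprocal `q`-factorial `1 / (q;q)_k` at an integer index; it vanishes for `k < 0`, which
makes the sums of the Bailey transform terminate naturally. -/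
noncomputable def qFactInv (q : ℂ) (k : ℤ) : ℂ := if k < 0 then 0 else (qPochInt q q k)⁻¹

@[simp] theorem qPochInt_zero (a q : ℂ) : qPochInt a q 0 = 1 := rfl

theorem qPochInt_ne_zero {a q : ℂ} (ha : ‖a‖ < 1) (hq : ‖q‖ < 1) (k : ℤ) :
    qPochInt a q k ≠ 0 :=
  qPoch_ne_zero ha hq _

theorem qPochInt_neg_ne_zero {q : ℂ} (hq : ‖q‖ < 1) (k : ℤ) : qPochInt (-q) q k ≠ 0 :=
  qPochInt_ne_zero (by rwa [norm_neg]) hq k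

theorem qPochInt_add_one (a q : ℂ) {k : ℤ} (hk : 0 ≤ k) :
    qPochInt a q (k + 1) = qPochInt a q k * (1 - a * q ^ k) := by
  lift k to ℕ using hk
  exact_mod_cast qPoch_succ a q k

theorem qPochInt_neg_add_one {q : ℂ} (hq0 : q ≠ 0) {k : ℤ} (hk : 0 ≤ k) :
    qPochInt (-q) q (k + 1) = qPochInt (-q) q k * (1 + q ^ (k + 1)) := by
  rw [qPochInt_add_one _ _ hk, zpow_add_one₀ hq0]
  ring

theorem qFactInv_of_neg (q : ℂ) {k : ℤ} (hk : k < 0) : qFactInv q k = 0 := if_pos hk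

theorem qFactInv_of_nonneg (q : ℂ) {k : ℤ} (hk : 0 ≤ k) : qFactInv q k = (qPochInt q q k)⁻¹ :=
  if_neg hk.not_gt

theorem qFactInv_zero (q : ℂ) : qFactInv q 0 = 1 := by
  rw [qFactInv_of_nonneg q le_rfl, qPochInt_zero, inv_one]

theorem qFactInv_sub_one {q : ℂ} (hq0 : q ≠ 0) (hq : ‖q‖ < 1) (k : ℤ) :
    qFactInv q (k - 1) = (1 - q ^ k) * qFactInv q k := by
  rcases lt_trichotomy k 0 with hk | rfl | hk
  · rw [qFactInv_of_neg _ hk, qFactInv_of_neg _ (by lia), mul_zero]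
  · rw [qFactInv_of_neg _ (by lia), zpow_zero, sub_self, zero_mul]
  · have hstep := qPochInt_add_one q q (k := k - 1) (by lia)
    rw [sub_add_cancel, ← zpow_one_add₀ hq0, add_sub_cancel] at hstep
    rw [qFactInv_of_nonneg _ (by lia), qFactInv_of_nonneg _ hk.le, hstep, mul_inv_rev,
      mul_inv_cancel_left₀ (one_sub_zpow_ne_zero hq hk)]

theorem qFactInv_eq_mul_add_one {q : ℂ} (hq0 : q ≠ 0) (hq : ‖q‖ < 1) (k : ℤ) :
    qFactInv q k = (1 - q ^ (k + 1)) * qFactInv q (k + 1) := by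
  simpa using qFactInv_sub_one hq0 hq (k + 1)

theorem qFactInv_eq_qPochInt_neg_mul {q : ℂ} (hq : ‖q‖ < 1) (k : ℤ) :
    qFactInv q k = qPochInt (-q) q k * qFactInv (q ^ 2) k := by
  rcases lt_or_ge k 0 with hk | hk
  · rw [qFactInv_of_neg _ hk, qFactInv_of_neg _ hk, mul_zero]
  · have hsq : qPochInt (q ^ 2) (q ^ 2) k = qPochInt q q k * qPochInt (-q) q k := qPoch_sq_sq q _
    rw [qFactInv_of_nonneg _ hk, qFactInv_of_nonneg _ hk, hsq, mul_inv_rev,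
      mul_inv_cancel_left₀ (qPochInt_neg_ne_zero hq k)]

theorem tendsto_qFactInv {q : ℂ} (hq : ‖q‖ < 1) :
    Tendsto (qFactInv q) atTop (𝓝 (qPochInf q q)⁻¹) := by
  have htoNat : Tendsto (fun k : ℤ => k.toNat) atTop atTop :=
    tendsto_atTop.mpr fun b => (eventually_ge_atTop (b : ℤ)).mono fun k hk => by lia
  refine (((tendsto_qPoch q hq).comp htoNat).inv₀ (qPochInf_ne_zero hq hq)).congr' ?_
  filter_upwards [eventually_ge_atTop (0 : ℤ)] with k hk
  exact (qFactInv_of_nonneg q hk).symm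

theorem exists_norm_qPochInt_inv_le {a q : ℂ} (ha : ‖a‖ < 1) (hq : ‖q‖ < 1) :
    ∃ C, ∀ k, ‖(qPochInt a q k)⁻¹‖ ≤ C := by
  obtain ⟨C, hC⟩ := ((tendsto_qPoch a hq).inv₀ (qPochInf_ne_zero ha hq)).norm.bddAbove_range
  exact ⟨C, fun k => hC ⟨k.toNat, rfl⟩⟩

theorem exists_norm_qFactInv_le {q : ℂ} (hq : ‖q‖ < 1) : ∃ C, ∀ k, ‖qFactInv q k‖ ≤ C := by
  obtain ⟨C, hC⟩ := exists_norm_qPochInt_inv_le hq hq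
  refine ⟨C, fun k => ?_⟩
  rcases lt_or_ge k 0 with hk | hk
  · rw [qFactInv_of_neg _ hk, norm_zero]
    exact (norm_nonneg _).trans (hC 0)
  · rw [qFactInv_of_nonneg _ hk]
    exact hC k

/-! ### The kernel of the Bailey transform -/

/-- The kernel `1 / ((q;q)_{n-j} (q;q)_{n+j+d})` of the Bailey transform relative to `q ^ d`; it is
supported on `-n - d ≤ j ≤ n`. -/
noncomputable def baileyKernel (q : ℂ) (d n j : ℤ) : ℂ :=
  qFactInv q (n - j) * qFactInv q (n + j + d)

theorem baileyKernel_eq_zero (q : ℂ) {d n j : ℤ} (h : j ∉ Set.Icc (-n - d) n) :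
    baileyKernel q d n j = 0 := by
  rw [Set.mem_Icc, not_and_or, not_le, not_le] at h
  rcases h with h | h
  · rw [baileyKernel, qFactInv_of_neg _ (by lia : n + j + d < 0), mul_zero]
  · rw [baileyKernel, qFactInv_of_neg _ (by lia : n - j < 0), zero_mul]

theorem baileyKernel_reflect (q : ℂ) (d n j : ℤ) :
    baileyKernel q d n (-d - j) = baileyKernel q d n j := by
  rw [baileyKernel, baileyKernel, mul_comm]
  congr 2 <;> ring

theorem exists_norm_baileyKernel_le {q : ℂ} (hq : ‖q‖ < 1) :
    ∃ C, ∀ d n j, ‖baileyKernel q d n j‖ ≤ C := by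
  obtain ⟨C, hC⟩ := exists_norm_qFactInv_le hq
  refine ⟨C * C, fun d n j => ?_⟩
  rw [baileyKernel, norm_mul]
  exact mul_le_mul (hC _) (hC _) (norm_nonneg _) ((norm_nonneg _).trans (hC 0))

theorem tendsto_baileyKernel {q : ℂ} (hq : ‖q‖ < 1) (d j : ℤ) :
    Tendsto (fun n => baileyKernel q d n j) atTop
      (𝓝 ((qPochInf q q)⁻¹ * (qPochInf q q)⁻¹)) := by
  refine ((tendsto_qFactInv hq).comp ?_).mul ((tendsto_qFactInv hq).comp ?_)
  · exact tendsto_atTop_add_const_right _ (-j) tendsto_id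
  · exact tendsto_atTop_add_const_right _ d (tendsto_atTop_add_const_right _ j tendsto_id)

theorem summable_mul_baileyKernel (q : ℂ) (g : ℤ → ℂ) (d n : ℤ) :
    Summable fun j => g j * baileyKernel q d n j := by
  refine summable_of_hasFiniteSupport ((Set.finite_Icc (-n - d) n).subset fun j hj => ?_)
  by_contra h
  exact hj (mul_eq_zero_of_right _ (baileyKernel_eq_zero q h))

section KernelRecurrences

variable {q : ℂ} (hq0 : q ≠ 0) (hq : ‖q‖ < 1) (d n j : ℤ)
include hq0 hq

theorem baileyKernel_eq_mul_shift :
    baileyKernel q d n j = (1 - q ^ (n + j + d + 1)) * baileyKernel q (d + 1) n j := by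
  rw [baileyKernel, baileyKernel, qFactInv_eq_mul_add_one hq0 hq (n + j + d), add_assoc (n + j)]
  ring

theorem baileyKernel_add_one_right :
    baileyKernel q d n (j + 1) = (1 - q ^ (n - j)) * baileyKernel q (d + 1) n j := by
  rw [baileyKernel, baileyKernel, ← sub_sub, qFactInv_sub_one hq0 hq, mul_assoc]
  congr 3
  ring

theorem baileyKernel_shift_eq_mul :
    baileyKernel q (d + 1) n j = (1 - q ^ (n + 1 - j)) * baileyKernel q d (n + 1) j := by
  rw [baileyKernel, baileyKernel, show n - j = n + 1 - j - 1 by ring, qFactInv_sub_one hq0 hq,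
    mul_assoc]
  congr 3
  ring

theorem baileyKernel_shift_sub_one_right :
    baileyKernel q (d + 1) n (j - 1) = (1 - q ^ (n + 1 + j + d)) * baileyKernel q d (n + 1) j := by
  rw [baileyKernel, baileyKernel, show n + (j - 1) + (d + 1) = n + 1 + j + d - 1 by ring,
    qFactInv_sub_one hq0 hq (n + 1 + j + d), show n - (j - 1) = n + 1 - j by ring]
  ring

end KernelRecurrences

/-! ### Theta series -/

/-- The exponents `j (j - 1) / 2` of theta series; the division is exact, see `two_mul_tri`. -/
def tri (j : ℤ) : ℤ := j * (j - 1) / 2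

theorem two_mul_tri (j : ℤ) : 2 * tri j = j * (j - 1) :=
  Int.mul_ediv_cancel' (by simpa [mul_comm] using (Int.even_mul_pred_self j).two_dvd)

theorem tri_zero : tri 0 = 0 := rfl

theorem tri_add_one (j : ℤ) : tri (j + 1) = tri j + j := by
  linarith [two_mul_tri j, two_mul_tri (j + 1)]

theorem tri_neg (j : ℤ) : tri (-j) = tri j + j := by
  linarith [two_mul_tri j, two_mul_tri (-j)]

theorem tri_one_sub (j : ℤ) : tri (1 - j) = tri j := by
  linarith [two_mul_tri j, two_mul_tri (1 - j)]

/-- The general term `(-z) ^ j q ^ (j (j - 1) / 2)` of Jacobi's theta series. -/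
noncomputable def thetaTerm (q z : ℂ) (j : ℤ) : ℂ := (-1) ^ j * q ^ tri j * z ^ j

theorem thetaTerm_ne_zero {q z : ℂ} (hq0 : q ≠ 0) (hz : z ≠ 0) (j : ℤ) : thetaTerm q z j ≠ 0 :=
  mul_ne_zero (mul_ne_zero (zpow_ne_zero _ (neg_ne_zero.mpr one_ne_zero)) (zpow_ne_zero _ hq0))
    (zpow_ne_zero _ hz)

theorem thetaTerm_add_one {q z : ℂ} (hq0 : q ≠ 0) (hz : z ≠ 0) (j : ℤ) :
    thetaTerm q z (j + 1) = -(z * q ^ j) * thetaTerm q z j := by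
  rw [thetaTerm, thetaTerm, tri_add_one, zpow_add₀ hq0, zpow_add_one₀ hz,
    zpow_add_one₀ (neg_ne_zero.mpr one_ne_zero)]
  ring

theorem thetaTerm_neg {q z : ℂ} (hq0 : q ≠ 0) (j : ℤ) :
    thetaTerm q z (-j) = thetaTerm q (q / z) j := by
  rw [thetaTerm, thetaTerm, tri_neg, zpow_add₀ hq0, div_zpow, zpow_neg, zpow_neg, ← inv_zpow,
    inv_neg_one, div_eq_mul_inv, mul_assoc, mul_assoc, mul_assoc]

theorem thetaTerm_one_sub {q z : ℂ} (hz : z ≠ 0) (j : ℤ) :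
    thetaTerm q z (1 - j) = -z * thetaTerm q z⁻¹ j := by
  rw [thetaTerm, thetaTerm, tri_one_sub, zpow_sub₀ hz, zpow_sub₀ (neg_ne_zero.mpr one_ne_zero),
    zpow_one, zpow_one, inv_zpow, div_eq_mul_inv, ← inv_zpow, inv_neg_one, div_eq_mul_inv]
  ring

theorem thetaTerm_pow_zpow {q : ℂ} (hq0 : q ≠ 0) (A : ℕ) (c j : ℤ) :
    thetaTerm (q ^ A) (q ^ c) j = (-1) ^ j * q ^ (A * tri j + c * j) := by
  rw [thetaTerm, ← zpow_natCast, ← zpow_mul, ← zpow_mul, mul_assoc, ← zpow_add₀ hq0]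

theorem thetaTerm_mul_zpow_quadratic {q : ℂ} (hq0 : q ≠ 0) (A B : ℕ) (c e j : ℤ) :
    thetaTerm (q ^ A) (q ^ c) j * q ^ (B * j ^ 2 + e * j) =
      thetaTerm (q ^ (A + 2 * B)) (q ^ (c + B + e)) j := by
  rw [thetaTerm_pow_zpow hq0, thetaTerm_pow_zpow hq0, mul_assoc, ← zpow_add₀ hq0]
  congr 2
  push_cast
  linear_combination -B * two_mul_tri j

theorem summable_thetaTerm {q z : ℂ} (hq0 : q ≠ 0) (hq : ‖q‖ < 1) (hz : z ≠ 0) :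
    Summable (thetaTerm q z) := by
  have summable_nat : ∀ w : ℂ, w ≠ 0 → Summable fun n : ℕ => thetaTerm q w n := by
    intro w hw
    refine summable_of_ratio_test_tendsto_lt_one zero_lt_one
      (Eventually.of_forall fun n => thetaTerm_ne_zero hq0 hw n) ?_
    have hratio : Tendsto (fun n : ℕ => ‖w‖ * ‖q‖ ^ n) atTop (𝓝 0) := by
      simpa using (tendsto_pow_atTop_nhds_zero_of_lt_one (norm_nonneg q) hq).const_mul ‖w‖
    refine hratio.congr fun n => ?_
    push_cast
    rw [thetaTerm_add_one hq0 hw, norm_mul,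
      mul_div_cancel_right₀ _ (norm_ne_zero_iff.mpr (thetaTerm_ne_zero hq0 hw _)), norm_neg,
      norm_mul, zpow_natCast, norm_pow]
  refine Summable.of_nat_of_neg (summable_nat z hz) ?_
  simpa only [thetaTerm_neg hq0] using summable_nat _ (div_ne_zero hq0 hz)

theorem summable_zpow_quadratic {q : ℂ} (hq0 : q ≠ 0) (hq : ‖q‖ < 1) {A : ℤ} (hA : 0 < A)
    (c : ℤ) : Summable fun j : ℤ => q ^ (A * j ^ 2 + c * j) := by
  lift A to ℕ using hA.le
  have hθ := (summable_thetaTerm (pow_ne_zero (2 * A) hq0) (norm_pow_lt_one hq (by lia))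
    (zpow_ne_zero (A + c) hq0)).norm
  refine Summable.of_norm (hθ.congr fun j => ?_)
  rw [thetaTerm_pow_zpow hq0, norm_mul, norm_zpow, norm_neg, norm_one, one_zpow, one_mul]
  congr 2
  push_cast
  linear_combination A * two_mul_tri j

/-! ### Jacobi's triple product -/

theorem hasSum_congr_of_eq {ι : Type*} {f g : ι → ℂ} {s t : ℂ} (hf : HasSum f s)
    (hgf : ∀ i, g i = f i) (hts : t = s) : HasSum g t :=
  hts ▸ hf.congr_fun hgf

theorem hasSum_comp_add_right {f : ℤ → ℂ} {s : ℂ} (hf : HasSum f s) (a : ℤ) :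
    HasSum (fun j => f (j + a)) s :=
  (Equiv.addRight a).hasSum_iff.mpr hf

theorem hasSum_comp_sub_right {f : ℤ → ℂ} {s : ℂ} (hf : HasSum f s) (a : ℤ) :
    HasSum (fun j => f (j - a)) s :=
  (Equiv.subRight a).hasSum_iff.mpr hf

section TripleProduct

variable {q z : ℂ} (hq0 : q ≠ 0) (hq : ‖q‖ < 1) (hz : z ≠ 0)
include hq0 hq hz

theorem tsum_thetaTerm_mul_baileyKernel_shift (d n : ℤ) :
    (1 - q ^ (2 * n + d + 1)) * ∑' j, thetaTerm q z j * baileyKernel q (d + 1) n j =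
      (1 - q ^ (n + d + 1) / z) * ∑' j, thetaTerm q z j * baileyKernel q d n j := by
  have hterm : ∀ j, (1 - q ^ (2 * n + d + 1)) * (thetaTerm q z j * baileyKernel q (d + 1) n j) =
      thetaTerm q z j * baileyKernel q d n j -
        q ^ (n + d + 1) / z * (thetaTerm q z (j + 1) * baileyKernel q d n (j + 1)) := by
    intro j
    rw [baileyKernel_eq_mul_shift hq0 hq d n j, baileyKernel_add_one_right hq0 hq d n j,
      thetaTerm_add_one hq0 hz, show n + j + d + 1 = n + d + 1 + j by ring,
      show 2 * n + d + 1 = n + d + 1 + n by ring, zpow_add₀ hq0 (n + d + 1),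
      zpow_add₀ hq0 (n + d + 1), zpow_sub₀ hq0]
    field_simp
    ring
  have hS := (summable_mul_baileyKernel q (thetaTerm q z) d n).hasSum
  have hsum :=
    (hS.sub ((hasSum_comp_add_right hS 1).mul_left (q ^ (n + d + 1) / z))).congr_fun hterm
  rw [← tsum_mul_left, hsum.tsum_eq]
  ring

theorem tsum_thetaTerm_mul_baileyKernel_add_one (d n : ℤ) :
    (1 - q ^ (2 * n + d + 2)) * ∑' j, thetaTerm q z j * baileyKernel q d (n + 1) j =
      (1 - z * q ^ n) * ∑' j, thetaTerm q z j * baileyKernel q (d + 1) n j := by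
  have hterm : ∀ j, (1 - q ^ (2 * n + d + 2)) * (thetaTerm q z j * baileyKernel q d (n + 1) j) =
      thetaTerm q z j * baileyKernel q (d + 1) n j -
        z * q ^ n * (thetaTerm q z (j - 1) * baileyKernel q (d + 1) n (j - 1)) := by
    intro j
    have hθ := thetaTerm_add_one hq0 hz (j - 1)
    rw [sub_add_cancel] at hθ
    rw [baileyKernel_shift_eq_mul hq0 hq d n j, baileyKernel_shift_sub_one_right hq0 hq d n j, hθ,
      show n + 1 + j + d = n + 1 + d + j by ring,
      show 2 * n + d + 2 = n + 1 + d + 1 + n by ring, show n + 1 - j = n - (j - 1) by ring,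
      zpow_sub₀ hq0 n, zpow_add₀ hq0 _ n, zpow_add₀ hq0 _ j, zpow_add_one₀ hq0 (n + 1 + d),
      zpow_sub_one₀ hq0]
    field_simp
    ring
  have hS := (summable_mul_baileyKernel q (thetaTerm q z) (d + 1) n).hasSum
  have hsum := (hS.sub ((hasSum_comp_sub_right hS 1).mul_left (z * q ^ n))).congr_fun hterm
  rw [← tsum_mul_left, hsum.tsum_eq]
  ring

theorem finite_triple_product (n : ℕ) :
    ∑' j, thetaTerm q z j * baileyKernel q 0 n j =
      qPoch z q n * qPoch (q / z) q n * qFactInv q (2 * n) := by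
  induction n with
  | zero =>
    rw [tsum_eq_single 0]
    · simp [baileyKernel, thetaTerm, tri_zero, qFactInv_zero]
    · intro j hj
      rw [baileyKernel_eq_zero _ (by rw [Set.mem_Icc]; push_cast; lia), mul_zero]
  | succ n ih =>
    have hstep₁ := tsum_thetaTerm_mul_baileyKernel_shift hq0 hq hz 0 n
    have hstep₂ := tsum_thetaTerm_mul_baileyKernel_add_one hq0 hq hz 0 n
    simp only [add_zero, zero_add] at hstep₁ hstep₂
    have hfact₁ := qFactInv_eq_mul_add_one hq0 hq (2 * n)
    have hfact₂ := qFactInv_eq_mul_add_one hq0 hq (2 * n + 1)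
    rw [add_assoc (2 * (n : ℤ)) 1 1, one_add_one_eq_two] at hfact₂
    have hz' : q ^ ((n : ℤ) + 1) / z = q / z * q ^ n := by
      rw [zpow_add_one₀ hq0, zpow_natCast]; ring
    rw [ih, hfact₁, hfact₂, hz'] at hstep₁
    rw [qPoch_succ, qPoch_succ, Nat.cast_add_one, mul_add_one]
    apply mul_left_cancel₀ (one_sub_zpow_ne_zero hq (by lia : 0 < 2 * (n : ℤ) + 2))
    apply mul_left_cancel₀ (one_sub_zpow_ne_zero hq (by lia : 0 < 2 * (n : ℤ) + 1))
    rw [hstep₂, zpow_natCast]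
    linear_combination (1 - z * q ^ n) * hstep₁

theorem jacobi_triple_product : HasSum (thetaTerm q z) (qPochInf₃ z (q / z) q q) := by
  have hs := summable_thetaTerm hq0 hq hz
  obtain ⟨C, hC⟩ := exists_norm_baileyKernel_le hq
  have hcast : Tendsto (fun n : ℕ => (n : ℤ)) atTop atTop := tendsto_natCast_atTop_atTop
  have hlim : Tendsto (fun n : ℕ => ∑' j, thetaTerm q z j * baileyKernel q 0 n j) atTop
      (𝓝 (∑' j, thetaTerm q z j * ((qPochInf q q)⁻¹ * (qPochInf q q)⁻¹))) := by
    refine tendsto_tsum_of_dominated_convergence (hs.norm.mul_right C)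
      (fun j => ((tendsto_baileyKernel hq 0 j).comp hcast).const_mul _)
      (Eventually.of_forall fun n j => ?_)
    rw [norm_mul]
    exact mul_le_mul_of_nonneg_left (hC _ _ _) (norm_nonneg _)
  have hlim' : Tendsto (fun n : ℕ => ∑' j, thetaTerm q z j * baileyKernel q 0 n j) atTop
      (𝓝 (qPochInf z q * qPochInf (q / z) q * (qPochInf q q)⁻¹)) := by
    simp only [finite_triple_product hq0 hq hz]
    refine ((tendsto_qPoch z hq).mul (tendsto_qPoch (q / z) hq)).mul
      ((tendsto_qFactInv hq).comp ?_)
    exact tendsto_atTop_mono (fun n => by lia) hcast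
  have heq := tendsto_nhds_unique hlim hlim'
  rw [tsum_mul_right] at heq
  have hP := qPochInf_ne_zero hq hq
  field_simp at heq
  rw [qPochInf₃, mul_comm, ← mul_assoc, ← heq]
  exact hs.hasSum

end TripleProduct

/-! ### Change of base -/

/-- The general term of the `q`-Vandermonde sum behind the change of base from `q` to `q ^ 2`. -/
noncomputable def vandermondeTerm (q : ℂ) (s m j : ℤ) : ℂ :=
  q ^ (j ^ 2 + s * j) * (qFactInv (q ^ 2) (m - j) * qFactInv q j * qFactInv q (j + s))

/-- The closed form of the sum of `vandermondeTerm q s m j` over `j`, see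
`tsum_vandermondeTerm`. -/
noncomputable def vandermondeValue (q : ℂ) (s m : ℤ) : ℂ :=
  qPochInt (-q) q (2 * m + s) * qFactInv (q ^ 2) m * qFactInv (q ^ 2) (m + s)

theorem vandermondeTerm_eq_zero (q : ℂ) {s m j : ℤ} (hj : j ∉ Set.Icc 0 m) :
    vandermondeTerm q s m j = 0 := by
  rw [Set.mem_Icc, not_and_or, not_le, not_le] at hj
  rcases hj with hj | hj
  · simp [vandermondeTerm, qFactInv_of_neg q hj]
  · simp [vandermondeTerm, qFactInv_of_neg (q ^ 2) (by lia : m - j < 0)]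

theorem summable_vandermondeTerm (q : ℂ) (s m : ℤ) : Summable (vandermondeTerm q s m) := by
  refine summable_of_hasFiniteSupport ((Set.finite_Icc 0 m).subset fun j hj => ?_)
  by_contra h
  exact hj (vandermondeTerm_eq_zero q h)

theorem sq_zpow (q : ℂ) (k : ℤ) : (q ^ 2) ^ k = q ^ (2 * k) := by
  rw [zpow_mul]
  rfl

theorem pow_four_zpow (q : ℂ) (k : ℤ) : (q ^ 4) ^ k = q ^ (4 * k) := by
  rw [zpow_mul]
  rfl

section ChangeOfBase

variable {q : ℂ} (hq0 : q ≠ 0) (hq : ‖q‖ < 1)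
include hq0 hq

theorem one_sub_mul_vandermondeTerm (s m j : ℤ) :
    (1 - q ^ (2 * (m + 1))) * vandermondeTerm q s (m + 1) j = vandermondeTerm q s m j +
      q ^ (2 * m + s + 1) * vandermondeTerm q s m (j - 1) +
      q ^ (2 * m + s + 2) * (1 + q ^ s) * vandermondeTerm q (s + 1) m (j - 1) := by
  have h₁ := qFactInv_sub_one (pow_ne_zero 2 hq0) (norm_pow_lt_one hq two_ne_zero) (m + 1 - j)
  have h₂ := qFactInv_sub_one hq0 hq j
  have h₃ := qFactInv_sub_one hq0 hq (j + s)
  have hj := zpow_ne_zero j hq0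
  have hs := zpow_ne_zero s hq0
  have e₁ : q ^ (2 * (m + 1 - j)) = q ^ (2 * m) * q ^ 2 / (q ^ j * q ^ j) := by
    rw [← zpow_natCast q 2, ← zpow_add₀ hq0, ← zpow_add₀ hq0, ← zpow_sub₀ hq0]
    congr 1; push_cast; ring
  have e₂ : q ^ ((j - 1) ^ 2 + s * (j - 1)) =
      q ^ (j ^ 2 + s * j) * q / (q ^ j * q ^ j * q ^ s) := by
    rw [← zpow_add_one₀ hq0, ← zpow_add₀ hq0, ← zpow_add₀ hq0, ← zpow_sub₀ hq0]
    congr 1; ring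
  have e₃ : q ^ ((j - 1) ^ 2 + (s + 1) * (j - 1)) = q ^ (j ^ 2 + s * j) / (q ^ j * q ^ s) := by
    rw [← zpow_add₀ hq0, ← zpow_sub₀ hq0]
    congr 1; ring
  simp only [vandermondeTerm]
  rw [show m - (j - 1) = m + 1 - j by ring, show j - 1 + s = j + s - 1 by ring,
    show j - 1 + (s + 1) = j + s by ring, show m - j = m + 1 - j - 1 by ring, h₁, h₂, h₃, sq_zpow,
    e₁, e₂, e₃, zpow_add₀ hq0 j s, add_assoc (2 * m), zpow_add₀ hq0 (2 * m) (s + 1),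
    add_assoc (2 * m), zpow_add₀ hq0 (2 * m) (s + 2), mul_add_one, zpow_add₀ hq0 (2 * m) 2,
    zpow_add_one₀ hq0, zpow_add₀ hq0 s 2, zpow_ofNat]
  field_simp
  ring

theorem one_sub_mul_tsum_vandermondeTerm (s m : ℤ) :
    (1 - q ^ (2 * (m + 1))) * ∑' j, vandermondeTerm q s (m + 1) j =
      (1 + q ^ (2 * m + s + 1)) * ∑' j, vandermondeTerm q s m j +
        q ^ (2 * m + s + 2) * (1 + q ^ s) * ∑' j, vandermondeTerm q (s + 1) m j := by
  have hs := (summable_vandermondeTerm q s m).hasSum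
  have hs' := (summable_vandermondeTerm q (s + 1) m).hasSum
  have hsum := ((hs.add ((hasSum_comp_sub_right hs 1).mul_left (q ^ (2 * m + s + 1)))).add
    ((hasSum_comp_sub_right hs' 1).mul_left (q ^ (2 * m + s + 2) * (1 + q ^ s)))).congr_fun
      (one_sub_mul_vandermondeTerm hq0 hq s m)
  rw [← tsum_mul_left, hsum.tsum_eq]
  ring

theorem one_sub_mul_vandermondeValue (s : ℤ) {m : ℤ} (hm : 0 ≤ m) :
    (1 - q ^ (2 * (m + 1))) * vandermondeValue q s (m + 1) =
      (1 + q ^ (2 * m + s + 1)) * vandermondeValue q s m +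
        q ^ (2 * m + s + 2) * (1 + q ^ s) * vandermondeValue q (s + 1) m := by
  have hq2 := norm_pow_lt_one hq two_ne_zero
  have h₁ := qFactInv_eq_mul_add_one (pow_ne_zero 2 hq0) hq2 m
  have h₂ := qFactInv_sub_one (pow_ne_zero 2 hq0) hq2 (m + 1 + s)
  rw [sq_zpow] at h₁ h₂
  rw [show m + 1 + s - 1 = m + s by ring] at h₂
  simp only [vandermondeValue]
  rw [show m + (s + 1) = m + 1 + s by ring, h₁, h₂]
  rcases lt_trichotomy (m + 1 + s) 0 with hs | hs | hs
  · simp only [qFactInv_of_neg _ hs, mul_zero, add_zero]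
  · obtain rfl : s = -(m + 1) := by lia
    have hm1 := zpow_ne_zero (m + 1) hq0
    rw [show 2 * m + (-(m + 1) + 1) = m by ring, show 2 * (m + 1) + -(m + 1) = m + 1 by ring,
      qPochInt_neg_add_one hq0 hm, add_neg_cancel, mul_zero, zpow_zero, zpow_neg,
      show 2 * m + -(m + 1) + 2 = m + 1 by ring]
    field_simp
    ring
  · rw [show 2 * (m + 1) + s = 2 * m + s + 1 + 1 by ring, ← add_assoc (2 * m),
      qPochInt_neg_add_one hq0 (by lia : 0 ≤ 2 * m + s + 1),
      qPochInt_neg_add_one hq0 (by lia : 0 ≤ 2 * m + s),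
      show 2 * (m + 1 + s) = (2 * m + s + 2) + s by ring, zpow_add₀ hq0 _ s,
      show 2 * m + s + 1 + 1 = 2 * m + s + 2 by ring]
    ring

theorem tsum_vandermondeTerm (s : ℤ) (m : ℕ) :
    ∑' j, vandermondeTerm q s m j = vandermondeValue q s m := by
  induction m generalizing s with
  | zero =>
    rw [tsum_eq_single 0]
    · simp [vandermondeTerm, vandermondeValue, qFactInv_zero,
        qFactInv_eq_qPochInt_neg_mul hq s]
    · exact fun j hj => vandermondeTerm_eq_zero q (by rw [Set.mem_Icc]; push_cast; lia)
  | succ m ih =>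
    rw [Nat.cast_add_one]
    apply mul_left_cancel₀ (one_sub_zpow_ne_zero hq (by lia : 0 < 2 * ((m : ℤ) + 1)))
    rw [one_sub_mul_tsum_vandermondeTerm hq0 hq, one_sub_mul_vandermondeValue hq0 hq s (by lia),
      ih, ih]

theorem hasSum_change_of_base (d N j : ℤ) :
    HasSum (fun k => q ^ (k ^ 2 + d * k) * (qFactInv (q ^ 2) (N - k) * baileyKernel q d k j))
      (qPochInt (-q) q (2 * N + d) * q ^ (j ^ 2 + d * j) * baileyKernel (q ^ 2) d N j) := by
  rcases lt_or_ge N j with hN | hN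
  · rw [baileyKernel_eq_zero _ (by rw [Set.mem_Icc]; lia), mul_zero]
    refine hasSum_zero.congr_fun fun k => ?_
    rcases lt_or_ge k j with hk | hk
    · rw [baileyKernel_eq_zero _ (by rw [Set.mem_Icc]; lia), mul_zero, mul_zero]
    · rw [qFactInv_of_neg _ (by lia), zero_mul, mul_zero]
  · obtain ⟨m, hm⟩ := Int.eq_ofNat_of_zero_le (sub_nonneg.mpr hN)
    obtain rfl : N = m + j := by lia
    have hsum := (hasSum_comp_sub_right
      (summable_vandermondeTerm q (2 * j + d) m).hasSum j).mul_left (q ^ (j ^ 2 + d * j))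
    rw [tsum_vandermondeTerm hq0 hq] at hsum
    refine hasSum_congr_of_eq hsum (fun k => ?_) ?_
    · rw [vandermondeTerm, ← mul_assoc (q ^ (j ^ 2 + d * j)), ← zpow_add₀ hq0, baileyKernel,
        show j ^ 2 + d * j + ((k - j) ^ 2 + (2 * j + d) * (k - j)) = k ^ 2 + d * k by ring,
        show (m : ℤ) - (k - j) = m + j - k by ring,
        show k - j + (2 * j + d) = k + j + d by ring, mul_assoc (qFactInv (q ^ 2) _)]
    · rw [baileyKernel, vandermondeValue, show 2 * ((m : ℤ) + j) + d = 2 * m + (2 * j + d) by ring,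
        add_sub_cancel_right, show (m : ℤ) + j + j + d = m + (2 * j + d) by ring]
      ring

theorem hasSum_change_of_base_shifted {N : ℤ} (hN : 0 ≤ N) (j : ℤ) :
    HasSum (fun k => q ^ k ^ 2 * (qFactInv (q ^ 2) (N - k) * baileyKernel q 1 k j))
      (qPochInt (-q) q (2 * N) * (q ^ j ^ 2 + q ^ (j + 1) ^ 2) * baileyKernel (q ^ 2) 1 N j) := by
  have hj := zpow_ne_zero j hq0
  refine hasSum_congr_of_eq (((hasSum_change_of_base hq0 hq 1 N j).mul_left (q ^ (-j))).add
    (hasSum_change_of_base hq0 hq 0 N (j + 1))) (fun k => ?_) ?_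
  · rw [baileyKernel_add_one_right hq0 hq, one_mul, zero_mul, add_zero, zero_add,
      zpow_add₀ hq0 (k ^ 2), zpow_sub₀ hq0, zpow_neg]
    field_simp
    ring
  · rw [baileyKernel_add_one_right (pow_ne_zero 2 hq0) (norm_pow_lt_one hq two_ne_zero), sq_zpow,
      one_mul, zero_mul, add_zero, add_zero, zero_add, qPochInt_neg_add_one hq0 (by lia),
      show 2 * (N - j) = 2 * N + 1 - (2 * j + 1) by ring, zpow_sub₀ hq0,
      show (j + 1) ^ 2 = j ^ 2 + (2 * j + 1) by ring, zpow_add₀ hq0 _ (2 * j + 1),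
      zpow_add₀ hq0 _ j, zpow_neg]
    have hj' := zpow_ne_zero (2 * j + 1) hq0
    field_simp
    ring

end ChangeOfBase

/-! ### The limiting Bailey transform -/

theorem qPochInf_sq_sq {q : ℂ} (hq : ‖q‖ < 1) :
    qPochInf (q ^ 2) (q ^ 2) = qPochInf q q * qPochInf (-q) q :=
  tendsto_nhds_unique (tendsto_qPoch (q ^ 2) (norm_pow_lt_one hq two_ne_zero))
    (((tendsto_qPoch q hq).mul (tendsto_qPoch (-q) hq)).congr fun m => (qPoch_sq_sq q m).symm)

theorem tendsto_qPochInt (a : ℂ) {q : ℂ} (hq : ‖q‖ < 1) :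
    Tendsto (qPochInt a q) atTop (𝓝 (qPochInf a q)) :=
  (tendsto_qPoch a hq).comp <|
    tendsto_atTop.mpr fun b => (eventually_ge_atTop (b : ℤ)).mono fun k hk => by lia

theorem tendsto_tsum_mul_qFactInv_sub {q : ℂ} (hq : ‖q‖ < 1) {w : ℤ → ℂ} (hw : Summable w) :
    Tendsto (fun N => ∑' k, w k * qFactInv q (N - k)) atTop
      (𝓝 ((∑' k, w k) * (qPochInf q q)⁻¹)) := by
  obtain ⟨C, hC⟩ := exists_norm_qFactInv_le hq
  rw [← tsum_mul_right]
  refine tendsto_tsum_of_dominated_convergence (hw.norm.mul_right C) (fun k => ?_)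
    (Eventually.of_forall fun N k => ?_)
  · exact ((tendsto_qFactInv hq).comp
      (tendsto_atTop_add_const_right _ (-k) tendsto_id)).const_mul _
  · rw [norm_mul]
    exact mul_le_mul_of_nonneg_left (hC _) (norm_nonneg _)

theorem summable_mul_baileyKernel_left {q : ℂ} (hq : ‖q‖ < 1) {w : ℤ → ℂ} (hw : Summable w)
    (d j : ℤ) : Summable fun k => w k * baileyKernel q d k j := by
  obtain ⟨C, hC⟩ := exists_norm_baileyKernel_le hq
  refine Summable.of_norm_bounded (hw.norm.mul_right C) fun k => ?_
  rw [norm_mul]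
  exact mul_le_mul_of_nonneg_left (hC d k j) (norm_nonneg _)

theorem hasSum_mul_baileyKernel_of_change_of_base {q : ℂ} (hq : ‖q‖ < 1) {d e j : ℤ}
    {w : ℤ → ℂ} {l : ℂ} (hw : Summable w)
    (hbase : ∀ N, 0 ≤ N →
      HasSum (fun k => w k * (qFactInv (q ^ 2) (N - k) * baileyKernel q d k j))
        (qPochInt (-q) q (2 * N + e) * l * baileyKernel (q ^ 2) d N j)) :
    HasSum (fun k => w k * baileyKernel q d k j) (l / qPochInf q q) := by
  have hq2 : ‖q ^ 2‖ < 1 := norm_pow_lt_one hq two_ne_zero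
  have hs := summable_mul_baileyKernel_left hq hw d j
  have hlim := tendsto_tsum_mul_qFactInv_sub hq2 hs
  have hlim' := (((tendsto_qPochInt (-q) hq).comp (tendsto_atTop_add_const_right _ e
    (tendsto_id.const_mul_atTop' two_pos))).mul_const l).mul (tendsto_baileyKernel hq2 d j)
  have hprelimit : ∀ N, 0 ≤ N → qPochInt (-q) q (2 * N + e) * l * baileyKernel (q ^ 2) d N j =
      ∑' k, w k * baileyKernel q d k j * qFactInv (q ^ 2) (N - k) := fun N hN => by
    rw [← (hbase N hN).tsum_eq]
    exact tsum_congr fun k => by rw [mul_assoc, mul_comm (baileyKernel q d k j)]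
  have heq := tendsto_nhds_unique hlim
    (hlim'.congr' ((eventually_ge_atTop 0).mono hprelimit))
  rw [qPochInf_sq_sq hq] at heq
  have hpos := qPochInf_ne_zero hq hq
  have hneg := qPochInf_ne_zero (a := -q) (by rwa [norm_neg]) hq
  field_simp at heq
  rw [← heq, mul_div_cancel_right₀ _ hpos]
  exact hs.hasSum

section Limit

variable {q : ℂ} (hq0 : q ≠ 0) (hq : ‖q‖ < 1)
include hq0 hq

theorem hasSum_bailey (d j : ℤ) :
    HasSum (fun n => q ^ (n ^ 2 + d * n) * baileyKernel q d n j)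
      (q ^ (j ^ 2 + d * j) / qPochInf q q) :=
  hasSum_mul_baileyKernel_of_change_of_base hq
    ((summable_zpow_quadratic hq0 hq one_pos d).congr fun n => by rw [one_mul])
    fun N _ => hasSum_change_of_base hq0 hq d N j

theorem hasSum_bailey_one_shifted (j : ℤ) :
    HasSum (fun n => q ^ n ^ 2 * baileyKernel q 1 n j)
      ((q ^ j ^ 2 + q ^ (j + 1) ^ 2) / qPochInf q q) :=
  hasSum_mul_baileyKernel_of_change_of_base (e := 0) hq
    ((summable_zpow_quadratic hq0 hq one_pos 0).congr fun n => by
      rw [one_mul, zero_mul, add_zero])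
    fun N hN => by simpa only [add_zero] using hasSum_change_of_base_shifted hq0 hq hN j

theorem hasSum_bailey_zero_shifted (j : ℤ) :
    HasSum (fun n => q ^ (n ^ 2 - n) * baileyKernel q 0 n j)
      ((q ^ (j ^ 2 - j) + q ^ (j ^ 2 + j)) / qPochInf q q) := by
  have hj := zpow_ne_zero j hq0
  refine hasSum_congr_of_eq (((hasSum_bailey hq0 hq 0 j).mul_left (q ^ (-j))).add
    (hasSum_comp_sub_right (hasSum_bailey hq0 hq 1 j) 1)) (fun n => ?_) ?_
  · have hK := baileyKernel_shift_eq_mul hq0 hq 0 (n - 1) j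
    rw [zero_add, sub_add_cancel] at hK
    rw [hK, show (n - 1) ^ 2 + 1 * (n - 1) = n ^ 2 - n by ring, zero_mul, add_zero,
      zpow_sub₀ hq0, zpow_sub₀ hq0 n j, zpow_neg]
    have hn := zpow_ne_zero n hq0
    field_simp
    ring
  · rw [zero_mul, add_zero, one_mul, zpow_sub₀ hq0, zpow_neg]
    field_simp

end Limit

/-! ### Bailey pairs -/

/-- `(α, β)` is a Bailey pair relative to `q ^ d`. The pair is encoded bilaterally: `α` is indexed
by `ℤ`, and the classical unilateral `α` at `j ≥ 0` is obtained by collecting the terms at `j` and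
`-d - j`. -/
def IsBaileyPair (q : ℂ) (d : ℤ) (α β : ℤ → ℂ) : Prop :=
  ∀ n, β n = ∑' j, α j * baileyKernel q d n j

namespace IsBaileyPair

variable {q : ℂ} {d : ℤ} {α β : ℤ → ℂ}

theorem of_change_of_kernel (h : IsBaileyPair q d α β) {q' : ℂ} {y : ℤ → ℤ → ℂ} {c : ℤ → ℂ}
    (hy : ∀ N r, N < r → y N r = 0)
    (hbase : ∀ N j, HasSum (fun r => y N r * baileyKernel q d r j)
      (c j * baileyKernel q' d N j)) :
    IsBaileyPair q' d (fun j => α j * c j) (fun N => ∑' r, y N r * β r) := by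
  intro N
  let F : ℤ → ℤ → ℂ := fun r j => α j * (y N r * baileyKernel q d r j)
  have hF : Summable (Function.uncurry F) := by
    refine summable_of_hasFiniteSupport
      (((Set.finite_Icc (-|d|) N).prod (Set.finite_Icc (-N - d) N)).subset fun z hz => ?_)
    have hzN : z.1 ≤ N := by
      by_contra hlt
      exact hz (by simp [F, Function.uncurry, hy N z.1 (not_le.mp hlt)])
    have hzK : z.2 ∈ Set.Icc (-z.1 - d) z.1 := by
      by_contra hout
      exact hz (by simp [F, Function.uncurry, baileyKernel_eq_zero q hout])
    rw [Set.mem_Icc] at hzK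
    have hd := le_abs_self d
    have hd₀ := abs_nonneg d
    rw [Set.mem_prod, Set.mem_Icc, Set.mem_Icc]
    lia
  calc ∑' r, y N r * β r = ∑' r, ∑' j, F r j := tsum_congr fun r => by
        rw [h r, ← tsum_mul_left]
        exact tsum_congr fun j => mul_left_comm _ _ _
    _ = ∑' j, ∑' r, F r j := hF.tsum_comm.symm
    _ = ∑' j, α j * c j * baileyKernel q' d N j := tsum_congr fun j => by
        rw [tsum_mul_left, (hbase N j).tsum_eq, mul_assoc]

theorem change_of_base (h : IsBaileyPair q d α β) (hq0 : q ≠ 0) (hq : ‖q‖ < 1) :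
    IsBaileyPair (q ^ 2) d (fun j => α j * q ^ (j ^ 2 + d * j)) (fun N => ∑' r,
      q ^ (r ^ 2 + d * r) * qFactInv (q ^ 2) (N - r) / qPochInt (-q) q (2 * N + d) * β r) := by
  refine h.of_change_of_kernel (fun N r hr => ?_) fun N j => ?_
  · rw [qFactInv_of_neg _ (by lia), mul_zero, zero_div]
  · have hne := qPochInt_neg_ne_zero hq (2 * N + d)
    refine hasSum_congr_of_eq ((hasSum_change_of_base hq0 hq d N j).div_const
      (qPochInt (-q) q (2 * N + d))) (fun r => ?_) ?_
    · ring
    · field_simp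

theorem change_of_base_shifted (h : IsBaileyPair q 1 α β) (hq0 : q ≠ 0) (hq : ‖q‖ < 1) :
    IsBaileyPair (q ^ 2) 1 (fun j => α j * (q ^ j ^ 2 + q ^ (j + 1) ^ 2)) (fun N => ∑' r,
      q ^ r ^ 2 * qFactInv (q ^ 2) (N - r) / qPochInt (-q) q (2 * N) * β r) := by
  refine h.of_change_of_kernel (fun N r hr => ?_) fun N j => ?_
  · rw [qFactInv_of_neg _ (by lia), mul_zero, zero_div]
  rcases lt_or_ge N 0 with hN | hN
  · rw [baileyKernel_eq_zero _ (by rw [Set.mem_Icc]; lia), mul_zero]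
    refine hasSum_zero.congr_fun fun r => ?_
    rcases lt_or_ge N r with hr | hr
    · rw [qFactInv_of_neg _ (by lia), mul_zero, zero_div, zero_mul]
    · rw [baileyKernel_eq_zero _ (by rw [Set.mem_Icc]; lia), mul_zero]
  · have hne := qPochInt_neg_ne_zero hq (2 * N)
    refine hasSum_congr_of_eq ((hasSum_change_of_base_shifted hq0 hq hN j).div_const
      (qPochInt (-q) q (2 * N))) (fun r => ?_) ?_
    · ring
    · field_simp

theorem hasSum_mul (h : IsBaileyPair q d α β) (hq : ‖q‖ < 1) {w l : ℤ → ℂ} (hα : Summable α)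
    (hw : Summable w) (hl : ∀ j, HasSum (fun n => w n * baileyKernel q d n j) (l j)) :
    HasSum (fun n => w n * β n) (∑' j, α j * l j) := by
  obtain ⟨C, hC⟩ := exists_norm_baileyKernel_le hq
  let F : ℤ → ℤ → ℂ := fun n j => α j * (w n * baileyKernel q d n j)
  have hF : Summable (Function.uncurry F) := by
    refine Summable.of_norm_bounded ((hw.norm.mul_of_nonneg hα.norm (fun _ => norm_nonneg _)
      (fun _ => norm_nonneg _)).mul_right C) fun z => ?_
    simp only [F, Function.uncurry, norm_mul]
    calc ‖α z.2‖ * (‖w z.1‖ * ‖baileyKernel q d z.1 z.2‖)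
        = ‖w z.1‖ * ‖α z.2‖ * ‖baileyKernel q d z.1 z.2‖ := by ring
      _ ≤ ‖w z.1‖ * ‖α z.2‖ * C := mul_le_mul_of_nonneg_left (hC _ _ _) (by positivity)
  have hsum : HasSum (fun n => ∑' j, F n j) (∑' n, ∑' j, F n j) := hF.prod.hasSum
  refine hasSum_congr_of_eq hsum (fun n => ?_) ?_
  · rw [h n, ← tsum_mul_left]
    exact tsum_congr fun j => mul_left_comm _ _ _
  · rw [← hF.tsum_comm]
    exact tsum_congr fun j => by rw [tsum_mul_left, (hl j).tsum_eq]

theorem hasSum_prod {f : ℤ → ℤ → ℂ} (h : IsBaileyPair q d α fun n => ∑' r, f n r)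
    (hq : ‖q‖ < 1) {w l : ℤ → ℂ} {s : ℂ} (hα : Summable α) (hw : Summable w)
    (hl : ∀ j, HasSum (fun n => w n * baileyKernel q d n j) (l j))
    (hs : HasSum (fun j => α j * l j) s) (hf : Summable fun z : ℤ × ℤ => w z.1 * f z.1 z.2) :
    HasSum (fun z : ℤ × ℤ => w z.1 * f z.1 z.2) s := by
  have hiter : HasSum (fun n => ∑' r, w n * f n r) s :=
    (hs.tsum_eq ▸ h.hasSum_mul hq hα hw hl).congr_fun fun n => tsum_mul_left
  exact (hf.tsum_prod.trans hiter.tsum_eq) ▸ hf.hasSum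

end IsBaileyPair

/-! ### Theta Bailey pairs -/

/-- The sequence forming a Bailey pair in base `q ^ 2`, relative to `q ^ (2 * d)`, with
`α j = (-1) ^ j q ^ (3 j (j - 1) / 2 + c j)`. -/
noncomputable def thetaBailey (q : ℂ) (d c n : ℤ) : ℂ :=
  ∑' j, thetaTerm (q ^ 3) (q ^ c) j * baileyKernel (q ^ 2) d n j

/-- The closed form `1 / ((q ^ 2;q ^ 2)_r (-q;q)_{2r+k})` taken by the Bailey sequences
`thetaBailey` for `k = 0, 1`. -/
noncomputable def betaProd (q : ℂ) (k r : ℤ) : ℂ :=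
  qFactInv (q ^ 2) r / qPochInt (-q) q (2 * r + k)

theorem betaProd_of_neg (q : ℂ) (k : ℤ) {r : ℤ} (hr : r < 0) : betaProd q k r = 0 := by
  rw [betaProd, qFactInv_of_neg _ hr, zero_div]

section ThetaBailey

variable {q : ℂ} (hq0 : q ≠ 0) (hq : ‖q‖ < 1)
include hq0 hq

theorem betaProd_eq_mul_add_one {k r : ℤ} (hk : 0 ≤ k) :
    betaProd q k r = (1 + q ^ (2 * r + k + 1)) * betaProd q (k + 1) r := by
  rcases lt_or_ge r 0 with hr | hr
  · rw [betaProd_of_neg q _ hr, betaProd_of_neg q _ hr, mul_zero]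
  · have h₁ := qPochInt_neg_ne_zero hq (2 * r + k)
    have h₂ := one_add_zpow_ne_zero hq (by lia : 0 < 2 * r + k + 1)
    rw [betaProd, betaProd, ← add_assoc, qPochInt_neg_add_one hq0 (by lia)]
    field_simp

theorem betaProd_one_sub_one (r : ℤ) :
    betaProd q 1 (r - 1) = (1 - q ^ (4 * r)) * betaProd q 0 r := by
  rcases lt_trichotomy r 0 with hr | rfl | hr
  · rw [betaProd_of_neg q _ hr, betaProd_of_neg q _ (by lia), mul_zero]
  · rw [betaProd_of_neg q _ (by lia), mul_zero, zpow_zero, sub_self, zero_mul]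
  · have h₁ := qPochInt_neg_ne_zero hq (2 * r - 1)
    have h₂ := one_add_zpow_ne_zero hq (by lia : 0 < 2 * r)
    have h₃ := qPochInt_neg_add_one hq0 (k := 2 * r - 1) (by lia)
    rw [sub_add_cancel] at h₃
    rw [betaProd, betaProd, qFactInv_sub_one (pow_ne_zero 2 hq0)
      (norm_pow_lt_one hq two_ne_zero), sq_zpow, show 2 * (r - 1) + 1 = 2 * r - 1 by ring,
      add_zero, h₃, show 4 * r = 2 * r + 2 * r by ring, zpow_add₀ hq0]
    field_simp
    ring

theorem thetaBailey_add_one_left (d c n : ℤ) :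
    thetaBailey q (d + 1) c n =
      thetaBailey q d c (n + 1) - q ^ (2 * n + 2) * thetaBailey q d (c - 2) (n + 1) := by
  have hK := baileyKernel_shift_eq_mul (pow_ne_zero 2 hq0) (norm_pow_lt_one hq two_ne_zero) d n
  rw [thetaBailey, thetaBailey, thetaBailey, ← tsum_mul_left,
    ← (summable_mul_baileyKernel _ _ _ _).tsum_sub ((summable_mul_baileyKernel _ _ _ _).mul_left _)]
  refine tsum_congr fun j => ?_
  have hexp : q ^ (c * j) * q ^ (2 * (n + 1 - j)) = q ^ (2 * n + 2) * q ^ ((c - 2) * j) := by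
    rw [← zpow_add₀ hq0, ← zpow_add₀ hq0]; congr 1; ring
  rw [hK j, sq_zpow, thetaTerm, thetaTerm, ← zpow_mul, ← zpow_mul]
  linear_combination -(-1) ^ j * (q ^ 3) ^ tri j * baileyKernel (q ^ 2) d (n + 1) j * hexp

theorem thetaBailey_eq_add_one_left (d c n : ℤ) :
    thetaBailey q d c n =
      thetaBailey q (d + 1) c n - q ^ (2 * n + 2 * d + 2) * thetaBailey q (d + 1) (c + 2) n := by
  have hK := baileyKernel_eq_mul_shift (pow_ne_zero 2 hq0) (norm_pow_lt_one hq two_ne_zero) d n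
  rw [thetaBailey, thetaBailey, thetaBailey, ← tsum_mul_left,
    ← (summable_mul_baileyKernel _ _ _ _).tsum_sub ((summable_mul_baileyKernel _ _ _ _).mul_left _)]
  refine tsum_congr fun j => ?_
  have hexp : q ^ (c * j) * q ^ (2 * (n + j + d + 1)) =
      q ^ (2 * n + 2 * d + 2) * q ^ ((c + 2) * j) := by
    rw [← zpow_add₀ hq0, ← zpow_add₀ hq0]; congr 1; ring
  rw [hK j, sq_zpow, thetaTerm, thetaTerm, ← zpow_mul, ← zpow_mul]
  linear_combination -(-1) ^ j * (q ^ 3) ^ tri j * baileyKernel (q ^ 2) (d + 1) n j * hexp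

omit hq in
theorem thetaBailey_zero_reflect (c n : ℤ) :
    thetaBailey q 0 (3 - c) n = thetaBailey q 0 c n := by
  rw [thetaBailey, thetaBailey, ← (Equiv.neg ℤ).tsum_eq]
  refine tsum_congr fun j => ?_
  have hK := baileyKernel_reflect (q ^ 2) 0 n j
  rw [neg_zero, zero_sub] at hK
  rw [Equiv.neg_apply, hK, thetaTerm_neg (pow_ne_zero 3 hq0), zpow_sub₀ hq0, zpow_ofNat,
    div_div_cancel₀ (pow_ne_zero 3 hq0)]

omit hq in
theorem thetaBailey_one_reflect (c n : ℤ) :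
    thetaBailey q 1 c n = -q ^ (3 - c) * thetaBailey q 1 (6 - c) n := by
  rw [thetaBailey, thetaBailey, ← (Equiv.subLeft (-1 : ℤ)).tsum_eq, ← tsum_mul_left]
  refine tsum_congr fun j => ?_
  have hθ := thetaTerm_add_one (pow_ne_zero 3 hq0) (zpow_ne_zero (3 - c) hq0) j
  have hexp : (q ^ 3) ^ j * (q ^ (3 - c)) ^ j = (q ^ (6 - c)) ^ j := by
    rw [← mul_zpow, ← zpow_natCast, ← zpow_add₀ hq0]; congr 2; push_cast; ring
  rw [Equiv.subLeft_apply, baileyKernel_reflect, show -1 - j = -(j + 1) by ring,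
    thetaTerm_neg (pow_ne_zero 3 hq0), ← zpow_ofNat q 3, ← zpow_sub₀ hq0, zpow_ofNat, hθ,
    thetaTerm, thetaTerm, ← hexp]
  ring

omit hq in
theorem thetaBailey_one_three (n : ℤ) : thetaBailey q 1 3 n = 0 := by
  have h := thetaBailey_one_reflect hq0 3 n
  norm_num at h
  exact self_eq_neg.mp h

theorem thetaBailey_one_two_eq (n : ℤ) :
    thetaBailey q 1 2 n = (1 - q ^ (4 * (n + 1))) * thetaBailey q 0 1 (n + 1) := by
  have h₃ := thetaBailey_add_one_left hq0 hq 0 3 n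
  have h₂ := thetaBailey_add_one_left hq0 hq 0 2 n
  have r₀ := thetaBailey_zero_reflect hq0 0 (n + 1)
  have r₁ := thetaBailey_zero_reflect hq0 1 (n + 1)
  norm_num at h₃ h₂ r₀ r₁
  have hexp : q ^ (4 * (n + 1)) = q ^ (2 * n + 2) * q ^ (2 * n + 2) := by
    rw [← zpow_add₀ hq0]; congr 1; ring
  rw [h₂, hexp, r₁, ← r₀]
  linear_combination -q ^ (2 * n + 2) * (thetaBailey_one_three hq0 n - h₃)

theorem thetaBailey_zero_one_eq (n : ℤ) :
    thetaBailey q 0 1 n = (1 + q ^ (2 * n + 1)) * thetaBailey q 1 2 n := by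
  have h := thetaBailey_eq_add_one_left hq0 hq 0 2 n
  have r₀ := thetaBailey_zero_reflect hq0 1 n
  have r₁ := thetaBailey_one_reflect hq0 4 n
  norm_num at h r₀ r₁
  rw [← r₀, h, r₁, show 2 * n + 2 = 2 * n + 1 + 1 by ring, zpow_add_one₀ hq0 (2 * n + 1)]
  field_simp
  ring

theorem thetaBailey_zero_one (n : ℤ) : thetaBailey q 0 1 n = betaProd q 0 n := by
  rcases lt_or_ge n 0 with hn | hn
  · rw [thetaBailey, betaProd_of_neg q _ hn]
    refine (tsum_congr fun j => ?_).trans tsum_zero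
    rw [baileyKernel_eq_zero _ (by rw [Set.mem_Icc]; lia), mul_zero]
  induction n, hn using Int.leInduction with
  | base =>
    rw [thetaBailey, tsum_eq_single 0]
    · simp [thetaTerm, baileyKernel, betaProd, tri_zero, qFactInv_zero]
    · intro j hj
      rw [baileyKernel_eq_zero _ (by rw [Set.mem_Icc]; lia), mul_zero]
  | succ n hn ih =>
    have hβ := betaProd_one_sub_one hq0 hq (n + 1)
    rw [add_sub_cancel_right] at hβ
    rw [thetaBailey_zero_one_eq hq0 hq, betaProd_eq_mul_add_one hq0 hq le_rfl, zero_add,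
      add_zero] at ih
    apply mul_left_cancel₀ (one_sub_zpow_ne_zero hq (by lia : 0 < 4 * (n + 1)))
    rw [← hβ, ← thetaBailey_one_two_eq hq0 hq]
    exact mul_left_cancel₀ (one_add_zpow_ne_zero hq (by lia : 0 < 2 * n + 1)) ih

theorem thetaBailey_one_two (n : ℤ) : thetaBailey q 1 2 n = betaProd q 1 n := by
  have hβ := betaProd_one_sub_one hq0 hq (n + 1)
  rw [add_sub_cancel_right] at hβ
  rw [thetaBailey_one_two_eq hq0 hq, thetaBailey_zero_one hq0 hq, hβ]

theorem thetaBailey_one_one (n : ℤ) : thetaBailey q 1 1 n = betaProd q 0 n := by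
  have h := thetaBailey_eq_add_one_left hq0 hq 0 1 n
  norm_num [thetaBailey_one_three hq0] at h
  rw [← h, thetaBailey_zero_one hq0 hq]

theorem thetaBailey_zero_three (n : ℤ) :
    thetaBailey q 0 3 n = q ^ (2 * n) * betaProd q 0 n := by
  have h := thetaBailey_add_one_left hq0 hq 0 3 (n - 1)
  norm_num [thetaBailey_one_three hq0] at h
  rw [sub_eq_zero.mp h.symm, thetaBailey_zero_one hq0 hq]
  congr 2
  ring

end ThetaBailey

/-! ### Theta functions of modulus 15 -/

/-- The theta series `∑ (-1) ^ j q ^ (15 j (j - 1) / 2 + c j)`; for `0 < c < 15` it is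
`(q ^ c, q ^ (15 - c), q ^ 15; q ^ 15)_∞`, see `thetaFifteen_eq_qPochInf₃`. -/
noncomputable def thetaFifteen (q : ℂ) (c : ℤ) : ℂ := ∑' j, thetaTerm (q ^ 15) (q ^ c) j

section ThetaFifteen

variable {q : ℂ} (hq0 : q ≠ 0)
include hq0

theorem hasSum_thetaFifteen (hq : ‖q‖ < 1) (c : ℤ) :
    HasSum (thetaTerm (q ^ 15) (q ^ c)) (thetaFifteen q c) :=
  (summable_thetaTerm (pow_ne_zero 15 hq0) (norm_pow_lt_one hq (by norm_num))
    (zpow_ne_zero c hq0)).hasSum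

theorem thetaFifteen_eq_qPochInf₃ (hq : ‖q‖ < 1) {a b : ℕ} (hab : a + b = 15) :
    thetaFifteen q a = qPochInf₃ (q ^ a) (q ^ b) (q ^ 15) (q ^ 15) := by
  have hdiv : q ^ 15 / q ^ a = q ^ b := by
    rw [← hab, pow_add, mul_div_cancel_left₀ _ (pow_ne_zero a hq0)]
  rw [← hdiv, thetaFifteen, zpow_natCast]
  exact (jacobi_triple_product (pow_ne_zero 15 hq0) (norm_pow_lt_one hq (by norm_num))
    (pow_ne_zero a hq0)).tsum_eq

theorem thetaFifteen_sub (c : ℤ) : thetaFifteen q (15 - c) = thetaFifteen q c := by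
  rw [thetaFifteen, thetaFifteen, ← (Equiv.neg ℤ).tsum_eq]
  refine tsum_congr fun j => ?_
  rw [Equiv.neg_apply, thetaTerm_neg (pow_ne_zero 15 hq0), zpow_sub₀ hq0, zpow_ofNat,
    div_div_cancel₀ (pow_ne_zero 15 hq0)]

theorem thetaFifteen_add (c : ℤ) : q ^ c * thetaFifteen q (15 + c) = -thetaFifteen q c := by
  have hneg : thetaFifteen q c = -q ^ c * thetaFifteen q (-c) := by
    rw [thetaFifteen, thetaFifteen, ← (Equiv.subLeft 1).tsum_eq, ← tsum_mul_left]
    refine tsum_congr fun j => ?_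
    rw [Equiv.subLeft_apply, thetaTerm_one_sub (zpow_ne_zero c hq0), zpow_neg]
  rw [hneg, ← thetaFifteen_sub hq0 (-c), sub_neg_eq_add]
  ring

theorem thetaFifteen_fifteen : thetaFifteen q 15 = 0 := by
  have hsub := thetaFifteen_sub hq0 0
  have hadd := thetaFifteen_add hq0 0
  rw [sub_zero] at hsub
  rw [add_zero, zpow_zero, one_mul, ← hsub] at hadd
  exact self_eq_neg.mp hadd

end ThetaFifteen

/-! ### Double series -/

/-- The factor `1 / ((-q ^ 2;q ^ 2)_{2N+i} (q ^ 2;q ^ 2)_r (-q;q)_{2r+k} (q ^ 4;q ^ 4)_{N-r})` of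
the summands of the double series, which are indexed by `(N, r)` with `N = n + r`. It vanishes
unless `0 ≤ r ≤ N`. -/
noncomputable def doubleWeight (q : ℂ) (i k : ℤ) (z : ℤ × ℤ) : ℂ :=
  betaProd q k z.2 * qFactInv (q ^ 4) (z.1 - z.2) / qPochInt (-q ^ 2) (q ^ 2) (2 * z.1 + i)

/-- The summand `q ^ (4 N ^ 2 + A N + 2 r ^ 2 + B r) * doubleWeight q i k (N, r)`, to which all
seven double series reduce. -/
noncomputable def doubleTerm (q : ℂ) (A B i k : ℤ) (z : ℤ × ℤ) : ℂ :=
  q ^ (4 * z.1 ^ 2 + A * z.1) * (q ^ (2 * z.2 ^ 2 + B * z.2) * doubleWeight q i k z)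

theorem doubleWeight_of_neg (q : ℂ) (i k : ℤ) {z : ℤ × ℤ} (hz : z.2 < 0) :
    doubleWeight q i k z = 0 := by
  rw [doubleWeight, betaProd_of_neg q k hz, zero_mul, zero_div]

theorem doubleWeight_of_lt (q : ℂ) (i k : ℤ) {z : ℤ × ℤ} (hz : z.1 < z.2) :
    doubleWeight q i k z = 0 := by
  rw [doubleWeight, qFactInv_of_neg _ (sub_neg.mpr hz), mul_zero, zero_div]

theorem exists_norm_doubleWeight_le {q : ℂ} (hq : ‖q‖ < 1) (i k : ℤ) :
    ∃ C, ∀ z, ‖doubleWeight q i k z‖ ≤ C := by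
  have hq2 : ‖q ^ 2‖ < 1 := norm_pow_lt_one hq two_ne_zero
  obtain ⟨C₁, h₁⟩ := exists_norm_qFactInv_le hq2
  obtain ⟨C₂, h₂⟩ := exists_norm_qPochInt_inv_le (a := -q) (by rwa [norm_neg]) hq
  obtain ⟨C₃, h₃⟩ := exists_norm_qFactInv_le (norm_pow_lt_one hq four_ne_zero)
  obtain ⟨C₄, h₄⟩ := exists_norm_qPochInt_inv_le (a := -q ^ 2) (by rwa [norm_neg]) hq2
  refine ⟨C₁ * C₂ * C₃ * C₄, fun z => ?_⟩
  have hC₁ := (norm_nonneg _).trans (h₁ 0)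
  have hC₂ := (norm_nonneg _).trans (h₂ 0)
  have hC₃ := (norm_nonneg _).trans (h₃ 0)
  rw [doubleWeight, betaProd, div_eq_mul_inv, div_eq_mul_inv, norm_mul, norm_mul, norm_mul]
  gcongr
  exacts [h₁ _, h₂ _, h₃ _, h₄ _]

section DoubleSeries

variable {q : ℂ} (hq0 : q ≠ 0) (hq : ‖q‖ < 1)
include hq0 hq

theorem summable_doubleTerm (A B i k : ℤ) : Summable (doubleTerm q A B i k) := by
  obtain ⟨C, hC⟩ := exists_norm_doubleWeight_le hq i k
  have hN := (summable_zpow_quadratic hq0 hq four_pos A).norm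
  have hr := (summable_zpow_quadratic hq0 hq two_pos B).norm
  refine Summable.of_norm_bounded ((hN.mul_of_nonneg hr (fun _ => norm_nonneg _)
    fun _ => norm_nonneg _).mul_right C) fun z => ?_
  rw [doubleTerm, norm_mul, norm_mul, ← mul_assoc]
  exact mul_le_mul_of_nonneg_left (hC z) (by positivity)

theorem hasSum_doubleTerm_of_isBaileyPair {d A B i k : ℤ} {α l : ℤ → ℂ} {s : ℂ}
    (h : IsBaileyPair (q ^ 4) d α fun N => ∑' r, q ^ (2 * r ^ 2 + B * r) *
      doubleWeight q i k (N, r))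
    (hα : Summable α)
    (hl : ∀ j, HasSum (fun N => q ^ (4 * N ^ 2 + A * N) * baileyKernel (q ^ 4) d N j) (l j))
    (hs : HasSum (fun j => α j * l j) s) : HasSum (doubleTerm q A B i k) s := by
  let f : ℤ → ℤ → ℂ := fun N r => q ^ (2 * r ^ 2 + B * r) * doubleWeight q i k (N, r)
  let w : ℤ → ℂ := fun N => q ^ (4 * N ^ 2 + A * N)
  exact IsBaileyPair.hasSum_prod (f := f) (w := w) h (norm_pow_lt_one hq four_ne_zero) hα
    (summable_zpow_quadratic hq0 hq four_pos A) hl hs (summable_doubleTerm hq0 hq A B i k)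

theorem summable_thetaTerm_seven (c : ℤ) : Summable (thetaTerm (q ^ 7) (q ^ c)) :=
  summable_thetaTerm (pow_ne_zero 7 hq0) (norm_pow_lt_one hq (by norm_num)) (zpow_ne_zero c hq0)

theorem hasSum_thetaTerm_seven_mul (c e : ℤ) :
    HasSum (fun j => thetaTerm (q ^ 7) (q ^ c) j * q ^ (4 * j ^ 2 + e * j))
      (thetaFifteen q (c + 4 + e)) :=
  (hasSum_thetaFifteen hq0 hq _).congr_fun (thetaTerm_mul_zpow_quadratic hq0 7 4 c e)

theorem isBaileyPair_doubleWeight {d c k B : ℤ}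
    (h : IsBaileyPair (q ^ 2) d (thetaTerm (q ^ 3) (q ^ c)) fun r => q ^ (B * r) * betaProd q k r) :
    IsBaileyPair (q ^ 4) d (thetaTerm (q ^ 7) (q ^ (c + 2 + 2 * d))) fun N =>
      ∑' r, q ^ (2 * r ^ 2 + (2 * d + B) * r) * doubleWeight q d k (N, r) := by
  have hpow : (q ^ 2) ^ 2 = q ^ 4 := by rw [← pow_mul]
  have hchange := h.change_of_base (pow_ne_zero 2 hq0) (norm_pow_lt_one hq two_ne_zero)
  rw [hpow] at hchange
  convert hchange using 1
  · funext j
    rw [sq_zpow, mul_add, ← mul_assoc]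
    exact (thetaTerm_mul_zpow_quadratic hq0 3 2 c (2 * d) j).symm
  · funext N
    refine tsum_congr fun r => ?_
    rw [doubleWeight, sq_zpow,
      show 2 * r ^ 2 + (2 * d + B) * r = 2 * (r ^ 2 + d * r) + B * r by ring, zpow_add₀ hq0]
    ring

theorem isBaileyPair_doubleWeight_shifted {c k : ℤ}
    (h : IsBaileyPair (q ^ 2) 1 (thetaTerm (q ^ 3) (q ^ c)) (betaProd q k)) :
    IsBaileyPair (q ^ 4) 1 (fun j => thetaTerm (q ^ 7) (q ^ (c + 2)) j +
        q ^ 2 * thetaTerm (q ^ 7) (q ^ (c + 6)) j) fun N =>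
      ∑' r, q ^ (2 * r ^ 2 + 0 * r) * doubleWeight q 0 k (N, r) := by
  have hpow : (q ^ 2) ^ 2 = q ^ 4 := by rw [← pow_mul]
  have hchange := h.change_of_base_shifted (pow_ne_zero 2 hq0) (norm_pow_lt_one hq two_ne_zero)
  rw [hpow] at hchange
  convert hchange using 1
  · funext j
    have h₀ := thetaTerm_mul_zpow_quadratic hq0 3 2 c 0 j
    have h₄ := thetaTerm_mul_zpow_quadratic hq0 3 2 c 4 j
    norm_num only [add_assoc, zero_mul, add_zero] at h₀ h₄
    rw [← h₀, ← h₄, sq_zpow, sq_zpow, show 2 * (j + 1) ^ 2 = 2 * j ^ 2 + 4 * j + 2 by ring,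
      zpow_add₀ hq0 _ 2, zpow_ofNat]
    ring
  · funext N
    refine tsum_congr fun r => ?_
    rw [doubleWeight, sq_zpow, zero_mul, add_zero, add_zero]
    ring

theorem hasSum_zpow_mul_baileyKernel (d j : ℤ) :
    HasSum (fun N => q ^ (4 * N ^ 2 + 4 * d * N) * baileyKernel (q ^ 4) d N j)
      (q ^ (4 * j ^ 2 + 4 * d * j) / qPochInf (q ^ 4) (q ^ 4)) := by
  have hexp : ∀ N : ℤ, (q ^ 4) ^ (N ^ 2 + d * N) = q ^ (4 * N ^ 2 + 4 * d * N) := fun N => by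
    rw [pow_four_zpow, mul_add, mul_assoc]
  simpa only [hexp] using
    hasSum_bailey (pow_ne_zero 4 hq0) (norm_pow_lt_one hq four_ne_zero) d j

theorem hasSum_zpow_mul_baileyKernel_one (j : ℤ) :
    HasSum (fun N => q ^ (4 * N ^ 2 + 0 * N) * baileyKernel (q ^ 4) 1 N j)
      ((q ^ (4 * j ^ 2 + 0 * j) + q ^ 4 * q ^ (4 * j ^ 2 + 8 * j)) / qPochInf (q ^ 4) (q ^ 4)) := by
  have h := hasSum_bailey_one_shifted (pow_ne_zero 4 hq0) (norm_pow_lt_one hq four_ne_zero) j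
  refine hasSum_congr_of_eq h (fun N => ?_) ?_
  · rw [pow_four_zpow, zero_mul, add_zero]
  · rw [pow_four_zpow, pow_four_zpow, ← zpow_ofNat q 4, ← zpow_add₀ hq0]
    ring_nf

theorem hasSum_zpow_mul_baileyKernel_zero (j : ℤ) :
    HasSum (fun N => q ^ (4 * N ^ 2 + (-4) * N) * baileyKernel (q ^ 4) 0 N j)
      ((q ^ (4 * j ^ 2 + (-4) * j) + q ^ (4 * j ^ 2 + 4 * j)) / qPochInf (q ^ 4) (q ^ 4)) := by
  have h := hasSum_bailey_zero_shifted (pow_ne_zero 4 hq0) (norm_pow_lt_one hq four_ne_zero) j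
  refine hasSum_congr_of_eq h (fun N => ?_) ?_
  · rw [pow_four_zpow]
    ring_nf
  · rw [pow_four_zpow, pow_four_zpow]
    ring_nf

/-! ### Evaluation of the double series -/

theorem isBaileyPair_zero_one :
    IsBaileyPair (q ^ 2) 0 (thetaTerm (q ^ 3) (q ^ (1 : ℤ))) (betaProd q 0) :=
  fun n => (thetaBailey_zero_one hq0 hq n).symm

theorem isBaileyPair_one_one :
    IsBaileyPair (q ^ 2) 1 (thetaTerm (q ^ 3) (q ^ (1 : ℤ))) (betaProd q 0) :=
  fun n => (thetaBailey_one_one hq0 hq n).symm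

theorem isBaileyPair_one_two :
    IsBaileyPair (q ^ 2) 1 (thetaTerm (q ^ 3) (q ^ (2 : ℤ))) (betaProd q 1) :=
  fun n => (thetaBailey_one_two hq0 hq n).symm

theorem isBaileyPair_zero_three :
    IsBaileyPair (q ^ 2) 0 (thetaTerm (q ^ 3) (q ^ (3 : ℤ)))
      fun r => q ^ (2 * r) * betaProd q 0 r :=
  fun n => (thetaBailey_zero_three hq0 hq n).symm

theorem hasSum_doubleTerm {d c k B : ℤ}
    (h : IsBaileyPair (q ^ 2) d (thetaTerm (q ^ 3) (q ^ c)) fun r => q ^ (B * r) * betaProd q k r) :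
    HasSum (doubleTerm q (4 * d) (2 * d + B) d k)
      (thetaFifteen q (c + 6 + 6 * d) / qPochInf (q ^ 4) (q ^ 4)) := by
  refine hasSum_doubleTerm_of_isBaileyPair hq0 hq (isBaileyPair_doubleWeight hq0 hq h)
    (summable_thetaTerm_seven hq0 hq _) (hasSum_zpow_mul_baileyKernel hq0 hq d)
    (hasSum_congr_of_eq ((hasSum_thetaTerm_seven_mul hq0 hq _ (4 * d)).div_const
      (qPochInf (q ^ 4) (q ^ 4))) (fun j => (mul_div_assoc _ _ _).symm) ?_)
  congr 2
  ring

theorem hasSum_doubleTerm_of_shifted_base {c k : ℤ}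
    (h : IsBaileyPair (q ^ 2) 1 (thetaTerm (q ^ 3) (q ^ c)) (betaProd q k)) :
    HasSum (doubleTerm q 4 0 0 k)
      ((thetaFifteen q (c + 10) + q ^ 2 * thetaFifteen q (c + 14)) / qPochInf (q ^ 4) (q ^ 4)) := by
  have hθ := (hasSum_thetaTerm_seven_mul hq0 hq (c + 2) 4).add
    ((hasSum_thetaTerm_seven_mul hq0 hq (c + 6) 4).mul_left (q ^ 2))
  refine hasSum_doubleTerm_of_isBaileyPair hq0 hq (isBaileyPair_doubleWeight_shifted hq0 hq h)
    ((summable_thetaTerm_seven hq0 hq _).add ((summable_thetaTerm_seven hq0 hq _).mul_left _))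
    (hasSum_zpow_mul_baileyKernel hq0 hq 1) (hasSum_congr_of_eq
      (hθ.div_const (qPochInf (q ^ 4) (q ^ 4))) (fun j => ?_) ?_)
  · rw [mul_one]
    ring
  · ring_nf

theorem hasSum_doubleTerm_of_shifted_limit_one {c k B : ℤ}
    (h : IsBaileyPair (q ^ 2) 1 (thetaTerm (q ^ 3) (q ^ c)) fun r => q ^ (B * r) * betaProd q k r) :
    HasSum (doubleTerm q 0 (2 + B) 1 k)
      ((thetaFifteen q (c + 8) + q ^ 4 * thetaFifteen q (c + 16)) / qPochInf (q ^ 4) (q ^ 4)) := by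
  have hβ := isBaileyPair_doubleWeight hq0 hq h
  rw [mul_one] at hβ
  have hθ := (hasSum_thetaTerm_seven_mul hq0 hq (c + 2 + 2) 0).add
    ((hasSum_thetaTerm_seven_mul hq0 hq (c + 2 + 2) 8).mul_left (q ^ 4))
  refine hasSum_doubleTerm_of_isBaileyPair hq0 hq hβ
    (summable_thetaTerm_seven hq0 hq _) (hasSum_zpow_mul_baileyKernel_one hq0 hq)
    (hasSum_congr_of_eq (hθ.div_const (qPochInf (q ^ 4) (q ^ 4))) (fun j => ?_) ?_)
  · ring
  · ring_nf

theorem hasSum_doubleTerm_of_shifted_limit_zero {c k B : ℤ}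
    (h : IsBaileyPair (q ^ 2) 0 (thetaTerm (q ^ 3) (q ^ c)) fun r => q ^ (B * r) * betaProd q k r) :
    HasSum (doubleTerm q (-4) B 0 k)
      ((thetaFifteen q (c + 2) + thetaFifteen q (c + 10)) / qPochInf (q ^ 4) (q ^ 4)) := by
  have hβ := isBaileyPair_doubleWeight hq0 hq h
  rw [mul_zero, zero_add, add_zero] at hβ
  have hθ := (hasSum_thetaTerm_seven_mul hq0 hq (c + 2) (-4)).add
    (hasSum_thetaTerm_seven_mul hq0 hq (c + 2) 4)
  refine hasSum_doubleTerm_of_isBaileyPair hq0 hq hβ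
    (summable_thetaTerm_seven hq0 hq _) (hasSum_zpow_mul_baileyKernel_zero hq0 hq)
    (hasSum_congr_of_eq (hθ.div_const (qPochInf (q ^ 4) (q ^ 4))) (fun j => ?_) ?_)
  · ring
  · ring_nf

end DoubleSeries

/-! ### Contiguous double series -/

theorem doubleWeight_of_left_neg (q : ℂ) (i k : ℤ) {z : ℤ × ℤ} (hz : z.1 < 0) :
    doubleWeight q i k z = 0 := by
  rcases lt_or_ge z.2 0 with hr | hr
  · exact doubleWeight_of_neg q i k hr
  · exact doubleWeight_of_lt q i k (hz.trans_le hr)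

section Contiguity

variable {q : ℂ} (hq0 : q ≠ 0) (hq : ‖q‖ < 1)
include hq0 hq

theorem doubleWeight_eq_mul_add_one_right (i : ℤ) {k : ℤ} (hk : 0 ≤ k) (z : ℤ × ℤ) :
    doubleWeight q i k z = (1 + q ^ (2 * z.2 + k + 1)) * doubleWeight q i (k + 1) z := by
  rw [doubleWeight, doubleWeight, betaProd_eq_mul_add_one hq0 hq hk]
  ring

theorem doubleWeight_zero_eq_mul_one (k : ℤ) (z : ℤ × ℤ) :
    doubleWeight q 0 k z = (1 + q ^ (4 * z.1 + 2)) * doubleWeight q 1 k z := by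
  rcases lt_or_ge z.1 0 with hN | hN
  · rw [doubleWeight_of_left_neg q 0 k hN, doubleWeight_of_left_neg q 1 k hN, mul_zero]
  · have hq2 := norm_pow_lt_one hq two_ne_zero
    have hP := qPochInt_neg_ne_zero hq2 (2 * z.1)
    have hone := one_add_zpow_ne_zero hq (by lia : 0 < 4 * z.1 + 2)
    have hstep := qPochInt_neg_add_one (pow_ne_zero 2 hq0) (by lia : 0 ≤ 2 * z.1)
    rw [sq_zpow, show 2 * (2 * z.1 + 1) = 4 * z.1 + 2 by ring] at hstep
    rw [doubleWeight, doubleWeight, add_zero, hstep]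
    field_simp

theorem one_sub_mul_doubleWeight_add_one (i N r : ℤ) :
    (1 - q ^ (2 * r + 2)) * doubleWeight q i 0 (N, r + 1) =
      (1 - q ^ (4 * (N - r))) * doubleWeight q i 2 (N, r) := by
  rcases lt_or_ge r 0 with hr | hr
  · rw [doubleWeight_of_neg q i 2 hr, mul_zero]
    rcases lt_or_ge (r + 1) 0 with hr' | hr'
    · rw [doubleWeight_of_neg q i 0 hr', mul_zero]
    · rw [show 2 * r + 2 = 0 by lia, zpow_zero, sub_self, zero_mul]
  · have hone := one_add_zpow_ne_zero hq (by lia : 0 < 2 * r + 2)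
    have hβ := betaProd_one_sub_one hq0 hq (r + 1)
    have hβ' := betaProd_eq_mul_add_one hq0 hq (k := 1) (r := r) zero_le_one
    have hF := qFactInv_sub_one (pow_ne_zero 4 hq0) (norm_pow_lt_one hq four_ne_zero) (N - r)
    rw [pow_four_zpow] at hF
    rw [add_assoc, one_add_one_eq_two] at hβ'
    rw [add_sub_cancel_right, hβ', show 4 * (r + 1) = 2 * r + 2 + (2 * r + 2) by ring,
      zpow_add₀ hq0 (2 * r + 2)] at hβ
    apply mul_left_cancel₀ hone
    rw [doubleWeight, doubleWeight, ← sub_sub, hF]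
    linear_combination -(1 - q ^ (4 * (N - r))) * qFactInv (q ^ 4) (N - r) /
      qPochInt (-q ^ 2) (q ^ 2) (2 * N + i) * hβ

theorem one_sub_mul_doubleWeight_add_one_left (N r : ℤ) :
    (1 - q ^ (8 * (N + 1))) * doubleWeight q 0 0 (N + 1, r) =
      doubleWeight q 1 0 (N, r) + q ^ (4 * (N + 1 - r)) * doubleWeight q 1 1 (N, r - 1) := by
  rcases lt_or_ge N 0 with hN | hN
  · rw [doubleWeight_of_left_neg q 1 0 hN, doubleWeight_of_left_neg q 1 1 hN, mul_zero, add_zero]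
    rcases lt_or_ge (N + 1) 0 with hN' | hN'
    · rw [doubleWeight_of_left_neg q 0 0 hN', mul_zero]
    · rw [show 8 * (N + 1) = 0 by lia, zpow_zero, sub_self, zero_mul]
  · have hq2 := norm_pow_lt_one hq two_ne_zero
    have hP := qPochInt_neg_ne_zero hq2 (2 * N + 1)
    have hone := one_add_zpow_ne_zero hq (by lia : 0 < 4 * (N + 1))
    have hstep := qPochInt_neg_add_one (pow_ne_zero 2 hq0) (by lia : 0 ≤ 2 * N + 1)
    rw [sq_zpow, show 2 * (2 * N + 1 + 1) = 4 * (N + 1) by ring] at hstep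
    have hF := qFactInv_sub_one (pow_ne_zero 4 hq0) (norm_pow_lt_one hq four_ne_zero) (N + 1 - r)
    rw [pow_four_zpow] at hF
    have h₈ : q ^ (8 * (N + 1)) = q ^ (4 * (N + 1)) * q ^ (4 * (N + 1)) := by
      rw [← zpow_add₀ hq0]; congr 1; ring
    have h₄ : q ^ (4 * (N + 1)) = q ^ (4 * (N + 1 - r)) * q ^ (4 * r) := by
      rw [← zpow_add₀ hq0]; congr 1; ring
    have hW : (1 + q ^ (4 * (N + 1))) * doubleWeight q 0 0 (N + 1, r) =
        betaProd q 0 r * qFactInv (q ^ 4) (N + 1 - r) / qPochInt (-q ^ 2) (q ^ 2) (2 * N + 1) := by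
      rw [doubleWeight, show 2 * (N + 1) + 0 = 2 * N + 1 + 1 by ring, hstep]
      field_simp
    have hW₀ : doubleWeight q 1 0 (N, r) = (1 - q ^ (4 * (N + 1 - r))) *
        (betaProd q 0 r * qFactInv (q ^ 4) (N + 1 - r) /
          qPochInt (-q ^ 2) (q ^ 2) (2 * N + 1)) := by
      rw [doubleWeight, show N - r = N + 1 - r - 1 by ring, hF]
      ring
    have hW₁ : doubleWeight q 1 1 (N, r - 1) = (1 - q ^ (4 * r)) *
        (betaProd q 0 r * qFactInv (q ^ 4) (N + 1 - r) /
          qPochInt (-q ^ 2) (q ^ 2) (2 * N + 1)) := by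
      rw [doubleWeight, betaProd_one_sub_one hq0 hq, show N - (r - 1) = N + 1 - r by ring]
      ring
    rw [hW₀, hW₁, ← hW, h₈, h₄]
    ring

end Contiguity

/-! ### Linear relations between the double series -/

/-- The double series `∑ q ^ (4 N ^ 2 + A N + 2 r ^ 2 + B r) * doubleWeight q i k (N, r)`. -/
noncomputable def doubleSum (q : ℂ) (A B i k : ℤ) : ℂ := ∑' z, doubleTerm q A B i k z

section Relations

variable {q : ℂ} (hq0 : q ≠ 0)
include hq0

theorem doubleTerm_add_left (A B e i k : ℤ) (z : ℤ × ℤ) :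
    doubleTerm q (A + e) B i k z = q ^ (e * z.1) * doubleTerm q A B i k z := by
  rw [doubleTerm, doubleTerm, add_mul, ← add_assoc, zpow_add₀ hq0 _ (e * z.1)]
  ring

theorem doubleTerm_add_right (A B e i k : ℤ) (z : ℤ × ℤ) :
    doubleTerm q A (B + e) i k z = q ^ (e * z.2) * doubleTerm q A B i k z := by
  rw [doubleTerm, doubleTerm, add_mul, ← add_assoc, zpow_add₀ hq0 _ (e * z.2)]
  ring

variable (hq : ‖q‖ < 1)
include hq

theorem hasSum_doubleSum (A B i k : ℤ) :
    HasSum (doubleTerm q A B i k) (doubleSum q A B i k) :=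
  (summable_doubleTerm hq0 hq A B i k).hasSum

theorem hasSum_doubleSum_shift (A B i k a b : ℤ) :
    HasSum (fun z : ℤ × ℤ => doubleTerm q A B i k (z.1 + a, z.2 + b)) (doubleSum q A B i k) :=
  (Equiv.addRight (a, b)).hasSum_iff.mpr (hasSum_doubleSum hq0 hq A B i k)

theorem doubleSum_zero_eq_add (A B k : ℤ) :
    doubleSum q A B 0 k = doubleSum q A B 1 k + q ^ 2 * doubleSum q (A + 4) B 1 k := by
  refine (hasSum_doubleSum hq0 hq A B 0 k).unique (((hasSum_doubleSum hq0 hq A B 1 k).add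
    ((hasSum_doubleSum hq0 hq (A + 4) B 1 k).mul_left (q ^ 2))).congr_fun fun z => ?_)
  rw [doubleTerm_add_left hq0, doubleTerm, doubleTerm, doubleWeight_zero_eq_mul_one hq0 hq,
    zpow_add₀ hq0 _ 2, zpow_ofNat]
  ring

theorem doubleSum_eq_add (A B i : ℤ) {k : ℤ} (hk : 0 ≤ k) :
    doubleSum q A B i k =
      doubleSum q A B i (k + 1) + q ^ (k + 1) * doubleSum q A (B + 2) i (k + 1) := by
  refine (hasSum_doubleSum hq0 hq A B i k).unique (((hasSum_doubleSum hq0 hq A B i (k + 1)).add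
    ((hasSum_doubleSum hq0 hq A (B + 2) i (k + 1)).mul_left _)).congr_fun fun z => ?_)
  rw [doubleTerm_add_right hq0, doubleTerm, doubleTerm,
    doubleWeight_eq_mul_add_one_right hq0 hq i hk, add_assoc, zpow_add₀ hq0 _ (k + 1)]
  ring

theorem doubleTerm_sub_add_one (A B i N r : ℤ) :
    doubleTerm q A B i 0 (N, r + 1) - doubleTerm q A (B + 2) i 0 (N, r + 1) =
      q ^ (B + 2) * (doubleTerm q A (B + 4) i 2 (N, r) - doubleTerm q (A + 4) B i 2 (N, r)) := by
  have hr : q ^ (2 * (r + 1) ^ 2 + B * (r + 1)) =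
      q ^ (2 * r ^ 2 + B * r) * q ^ (4 * r) * q ^ (B + 2) := by
    rw [← zpow_add₀ hq0, ← zpow_add₀ hq0]; congr 1; ring
  have hN : q ^ (4 * N) = q ^ (4 * (N - r)) * q ^ (4 * r) := by
    rw [← zpow_add₀ hq0]; congr 1; ring
  have hW := one_sub_mul_doubleWeight_add_one hq0 hq i N r
  rw [doubleTerm_add_right hq0, doubleTerm_add_right hq0, doubleTerm_add_left hq0]
  simp only [doubleTerm, hr, hN, show 2 * (r + 1) = 2 * r + 2 by ring]
  linear_combination q ^ (4 * N ^ 2 + A * N) * q ^ (2 * r ^ 2 + B * r) * q ^ (4 * r) *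
    q ^ (B + 2) * hW

theorem doubleSum_sub_add_two_right (A B i : ℤ) :
    doubleSum q A B i 0 - doubleSum q A (B + 2) i 0 =
      q ^ (B + 2) * (doubleSum q A (B + 4) i 2 - doubleSum q (A + 4) B i 2) := by
  have hleft := (hasSum_doubleSum_shift hq0 hq A B i 0 0 1).sub
    (hasSum_doubleSum_shift hq0 hq A (B + 2) i 0 0 1)
  have hright := ((hasSum_doubleSum hq0 hq A (B + 4) i 2).sub
    (hasSum_doubleSum hq0 hq (A + 4) B i 2)).mul_left (q ^ (B + 2))
  refine hleft.unique (hright.congr_fun fun z => ?_)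
  rw [add_zero]
  exact doubleTerm_sub_add_one hq0 hq A B i z.1 z.2

theorem doubleTerm_sub_add_one_left (A B N r : ℤ) :
    doubleTerm q A B 0 0 (N + 1, r + 1) - doubleTerm q (A + 8) B 0 0 (N + 1, r + 1) =
      q ^ (A + 4) * (doubleTerm q (A + 8) B 1 0 (N, r + 1) +
        q ^ (B + 2) * doubleTerm q (A + 12) B 1 1 (N, r)) := by
  have hN : q ^ (4 * (N + 1) ^ 2 + A * (N + 1)) =
      q ^ (4 * N ^ 2 + A * N) * q ^ (8 * N) * q ^ (A + 4) := by
    rw [← zpow_add₀ hq0, ← zpow_add₀ hq0]; congr 1; ring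
  have hr : q ^ (2 * (r + 1) ^ 2 + B * (r + 1)) =
      q ^ (2 * r ^ 2 + B * r) * q ^ (4 * r) * q ^ (B + 2) := by
    rw [← zpow_add₀ hq0, ← zpow_add₀ hq0]; congr 1; ring
  have h₁₂ : q ^ (12 * N) = q ^ (8 * N) * (q ^ (4 * (N - r)) * q ^ (4 * r)) := by
    rw [← zpow_add₀ hq0, ← zpow_add₀ hq0]; congr 1; ring
  have hW := one_sub_mul_doubleWeight_add_one_left hq0 hq N (r + 1)
  rw [add_sub_cancel_right, add_sub_add_right_eq_sub] at hW
  rw [doubleTerm_add_left hq0, doubleTerm_add_left hq0, doubleTerm_add_left hq0]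
  simp only [doubleTerm, hr, hN, h₁₂]
  linear_combination q ^ (4 * N ^ 2 + A * N) * q ^ (8 * N) * q ^ (A + 4) *
    q ^ (2 * r ^ 2 + B * r) * q ^ (4 * r) * q ^ (B + 2) * hW

theorem doubleSum_sub_add_eight_left (A B : ℤ) :
    doubleSum q A B 0 0 - doubleSum q (A + 8) B 0 0 =
      q ^ (A + 4) * (doubleSum q (A + 8) B 1 0 + q ^ (B + 2) * doubleSum q (A + 12) B 1 1) := by
  have hleft := (hasSum_doubleSum_shift hq0 hq A B 0 0 1 1).sub
    (hasSum_doubleSum_shift hq0 hq (A + 8) B 0 0 1 1)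
  have hright := ((hasSum_doubleSum_shift hq0 hq (A + 8) B 1 0 0 1).add
    ((hasSum_doubleSum hq0 hq (A + 12) B 1 1).mul_left (q ^ (B + 2)))).mul_left (q ^ (A + 4))
  refine hleft.unique (hright.congr_fun fun z => ?_)
  rw [add_zero]
  exact doubleTerm_sub_add_one_left hq0 hq A B z.1 z.2

end Relations

section Evaluation

variable {q : ℂ} (hq0 : q ≠ 0) (hq : ‖q‖ < 1)
include hq0 hq

theorem doubleSum_eq_theta_one :
    doubleSum q 4 2 1 1 = thetaFifteen q 1 / qPochInf (q ^ 4) (q ^ 4) := by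
  rw [← thetaFifteen_sub hq0 1]
  exact (hasSum_doubleTerm hq0 hq (d := 1) (c := 2) (k := 1) (B := 0)
    (by simpa using isBaileyPair_one_two hq0 hq)).tsum_eq

theorem doubleSum_eq_theta_two :
    doubleSum q 4 2 1 0 = thetaFifteen q 2 / qPochInf (q ^ 4) (q ^ 4) := by
  rw [← thetaFifteen_sub hq0 2]
  exact (hasSum_doubleTerm hq0 hq (d := 1) (c := 1) (k := 0) (B := 0)
    (by simpa using isBaileyPair_one_one hq0 hq)).tsum_eq

theorem doubleSum_eq_theta_four :
    doubleSum q 4 0 0 0 = thetaFifteen q 4 / qPochInf (q ^ 4) (q ^ 4) := by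
  have h := (hasSum_doubleTerm_of_shifted_base hq0 hq (isBaileyPair_one_one hq0 hq)).tsum_eq
  norm_num only [thetaFifteen_fifteen hq0, mul_zero, add_zero] at h
  rw [← thetaFifteen_sub hq0 4]
  exact h

theorem doubleSum_eq_theta_six :
    doubleSum q 0 2 0 0 = thetaFifteen q 6 / qPochInf (q ^ 4) (q ^ 4) := by
  rw [← thetaFifteen_sub hq0 6]
  exact (hasSum_doubleTerm hq0 hq (isBaileyPair_zero_three hq0 hq)).tsum_eq

theorem doubleSum_eq_theta_seven :
    doubleSum q 0 0 0 0 = thetaFifteen q 7 / qPochInf (q ^ 4) (q ^ 4) :=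
  (hasSum_doubleTerm hq0 hq (d := 0) (c := 1) (k := 0) (B := 0)
    (by simpa using isBaileyPair_zero_one hq0 hq)).tsum_eq

theorem doubleSum_sub_eq_theta_three :
    doubleSum q (-4) 0 0 0 - doubleSum q 4 0 0 0 =
      thetaFifteen q 3 / qPochInf (q ^ 4) (q ^ 4) := by
  have h := (hasSum_doubleTerm_of_shifted_limit_zero hq0 hq (c := 1) (k := 0) (B := 0)
    (by simpa using isBaileyPair_zero_one hq0 hq)).tsum_eq
  rw [← doubleSum] at h
  rw [h, doubleSum_eq_theta_four hq0 hq, ← thetaFifteen_sub hq0 4]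
  ring_nf

theorem doubleSum_add_eq_theta_five :
    doubleSum q 0 2 0 1 + q * doubleSum q 4 0 0 1 =
      thetaFifteen q 5 / qPochInf (q ^ 4) (q ^ 4) := by
  have hlimit : doubleSum q 0 2 1 1 = _ := (hasSum_doubleTerm_of_shifted_limit_one hq0 hq
    (c := 2) (k := 1) (B := 0) (by simpa using isBaileyPair_one_two hq0 hq)).tsum_eq
  have hbase : doubleSum q 4 0 0 1 = _ :=
    (hasSum_doubleTerm_of_shifted_base hq0 hq (isBaileyPair_one_two hq0 hq)).tsum_eq
  have hsplit := doubleSum_zero_eq_add hq0 hq 0 2 1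
  have h₁ := thetaFifteen_add hq0 1
  have h₃ := thetaFifteen_add hq0 3
  rw [← thetaFifteen_sub hq0 5, hsplit, zero_add, doubleSum_eq_theta_one hq0 hq, hlimit, hbase]
  rw [zpow_ofNat, ← thetaFifteen_sub hq0 3] at h₃
  rw [zpow_one] at h₁
  norm_num only at h₁ h₃ ⊢
  linear_combination (q ^ 2 * h₁ + q * h₃) / qPochInf (q ^ 4) (q ^ 4)

theorem doubleSum_combination_eq_theta_three :
    doubleSum q 4 2 1 2 + (q + 2 * q ^ 2) * doubleSum q 4 4 1 2 + q ^ 3 * doubleSum q 4 6 1 2 +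
      q ^ 4 * doubleSum q 8 2 1 2 = thetaFifteen q 3 / qPochInf (q ^ 4) (q ^ 4) := by
  have hleft := doubleSum_sub_add_eight_left hq0 hq (-4) 0
  have hright := doubleSum_sub_add_two_right hq0 hq 4 0 1
  have h₁ := doubleSum_eq_add hq0 hq 4 2 1 (k := 0) le_rfl
  have h₂ := doubleSum_eq_add hq0 hq 4 2 1 (k := 1) zero_le_one
  have h₃ := doubleSum_eq_add hq0 hq 4 4 1 (k := 1) zero_le_one
  have h₄ := doubleSum_eq_add hq0 hq 8 0 1 (k := 1) zero_le_one
  norm_num only [zpow_ofNat, zpow_zero, zpow_one, zero_add] at hleft hright h₁ h₂ h₃ h₄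
  rw [← doubleSum_sub_eq_theta_three hq0 hq]
  linear_combination -hleft - hright - h₁ - h₂ - q * h₃ - q ^ 2 * h₄

theorem doubleSum_combination_eq_theta_four :
    (1 + q ^ 2) * doubleSum q 0 4 0 1 + q * doubleSum q 0 6 0 1 + q ^ 3 * doubleSum q 4 2 0 1 -
      doubleSum q 0 0 0 1 - q * doubleSum q 0 2 0 1 =
      q ^ 2 * (thetaFifteen q 4 / qPochInf (q ^ 4) (q ^ 4)) := by
  have hshift₀ := doubleSum_sub_add_two_right hq0 hq 0 0 0
  have hshift₂ := doubleSum_sub_add_two_right hq0 hq 0 2 0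
  have h₁ := doubleSum_eq_add hq0 hq 0 4 0 (k := 1) zero_le_one
  have h₂ := doubleSum_eq_add hq0 hq 4 0 0 (k := 1) zero_le_one
  have h₃ := doubleSum_eq_add hq0 hq 0 0 0 (k := 0) le_rfl
  have h₄ := doubleSum_eq_add hq0 hq 0 4 0 (k := 0) le_rfl
  have h₅ := doubleSum_eq_add hq0 hq 4 0 0 (k := 0) le_rfl
  norm_num only [zpow_ofNat, zpow_zero, zpow_one, zero_add] at hshift₀ hshift₂ h₁ h₂ h₃ h₄ h₅
  rw [← doubleSum_eq_theta_four hq0 hq]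
  linear_combination h₃ - h₄ - hshift₀ - hshift₂ + q ^ 2 * (h₁ - h₂ - h₅)

end Evaluation

/-! ### Passage to sums over `ℕ × ℕ` -/

/-- The denominator `(-q ^ 2;q ^ 2)_{2n+2r+i} (q ^ 2;q ^ 2)_r (-q;q)_{2r+k} (q ^ 4;q ^ 4)_n` of the
double series over `(n, r)`. -/
def doubleDenom (q : ℂ) (i k : ℕ) (p : ℕ × ℕ) : ℂ :=
  qPoch (-q ^ 2) (q ^ 2) (2 * p.1 + 2 * p.2 + i) * qPoch (q ^ 2) (q ^ 2) p.2 *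
    qPoch (-q) q (2 * p.2 + k) * qPoch (q ^ 4) (q ^ 4) p.1

theorem doubleWeight_natCast (q : ℂ) (i k n r : ℕ) :
    doubleWeight q i k (n + r, r) = (doubleDenom q i k (n, r))⁻¹ := by
  rw [doubleWeight, betaProd, qFactInv_of_nonneg _ (Int.natCast_nonneg r), add_sub_cancel_right,
    qFactInv_of_nonneg _ (Int.natCast_nonneg n),
    show 2 * ((n : ℤ) + r) + i = (2 * n + 2 * r + i : ℕ) by push_cast; ring,
    show 2 * (r : ℤ) + k = (2 * r + k : ℕ) by push_cast; ring, doubleDenom]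
  simp only [qPochInt, Int.toNat_natCast]
  ring

theorem doubleTerm_natCast {q : ℂ} (hq0 : q ≠ 0) (A B i k n r : ℕ) :
    doubleTerm q A B i k (n + r, r) =
      q ^ (4 * n ^ 2 + 8 * n * r + 6 * r ^ 2 + A * (n + r) + B * r) / doubleDenom q i k (n, r) := by
  rw [doubleTerm, doubleWeight_natCast, ← mul_assoc, ← zpow_add₀ hq0, div_eq_mul_inv,
    ← zpow_natCast]
  congr 2
  push_cast
  ring

theorem hasSum_natCast {f : ℤ × ℤ → ℂ} {s : ℂ} (hf : HasSum f s)
    (hneg : ∀ z, z.2 < 0 → f z = 0) (hlt : ∀ z, z.1 < z.2 → f z = 0) :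
    HasSum (fun p : ℕ × ℕ => f (p.1 + p.2, p.2)) s := by
  have hinj : Function.Injective fun p : ℕ × ℕ => ((p.1 : ℤ) + p.2, (p.2 : ℤ)) := by
    rintro ⟨a, b⟩ ⟨c, d⟩ h
    simp only [Prod.mk.injEq] at h ⊢
    lia
  refine (hinj.hasSum_iff fun z hz => ?_).mpr hf
  by_contra hne
  have hr : 0 ≤ z.2 := not_lt.mp fun h => hne (hneg z h)
  have hN : z.2 ≤ z.1 := not_lt.mp fun h => hne (hlt z h)
  exact hz ⟨((z.1 - z.2).toNat, z.2.toNat), Prod.ext (by simp; lia) (by simp; lia)⟩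

theorem hasSum_pow_div_doubleDenom {q : ℂ} (hq0 : q ≠ 0) (hq : ‖q‖ < 1) (A B i k : ℕ) :
    HasSum (fun p : ℕ × ℕ =>
        q ^ (4 * p.1 ^ 2 + 8 * p.1 * p.2 + 6 * p.2 ^ 2 + A * (p.1 + p.2) + B * p.2) /
          doubleDenom q i k p)
      (doubleSum q A B i k) := by
  refine (hasSum_natCast (hasSum_doubleSum hq0 hq A B i k)
    (fun z hz => ?_) fun z hz => ?_).congr_fun
      fun p => (doubleTerm_natCast hq0 A B i k p.1 p.2).symm
  · rw [doubleTerm, doubleWeight_of_neg q i k hz, mul_zero, mul_zero]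
  · rw [doubleTerm, doubleWeight_of_lt q i k hz, mul_zero, mul_zero]

theorem qPochInf_zero_left (q : ℂ) : qPochInf 0 q = 1 := by simp [qPochInf]

theorem hasSum_zero_pow_mul {ι : Type*} {E : ι → ℕ} {a : ι} (hE : ∀ b, E b = 0 ↔ b = a)
    (f : ι → ℂ) : HasSum (fun b => 0 ^ E b * f b) (f a) := by
  have h := hasSum_single (f := fun b => 0 ^ E b * f b) a fun b hb => by
    rw [zero_pow (mt (hE b).mp hb), zero_mul]
  rwa [(hE a).mpr rfl, pow_zero, one_mul] at h

theorem hasSum_qPochInf₃_of_thetaFifteen {q : ℂ} (hq : ‖q‖ < 1) {E : ℕ × ℕ → ℕ} {c : ℕ × ℕ → ℂ}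
    {A B i k a b : ℕ}
    (hE : ∀ p, E p = 4 * p.1 ^ 2 + 8 * p.1 * p.2 + 6 * p.2 ^ 2 + A * (p.1 + p.2) + B * p.2)
    (hc : q = 0 → c 0 = 1) (ha : 0 < a) (hb : 0 < b) (hab : a + b = 15)
    (h : q ≠ 0 → HasSum (fun p => q ^ E p * c p / doubleDenom q i k p)
      (thetaFifteen q a / qPochInf (q ^ 4) (q ^ 4))) :
    HasSum (fun p => q ^ E p * c p / doubleDenom q i k p)
      (qPochInf₃ (q ^ a) (q ^ b) (q ^ 15) (q ^ 15) / qPochInf (q ^ 4) (q ^ 4)) := by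
  rcases eq_or_ne q 0 with rfl | hq0
  · have hone : c 0 / doubleDenom 0 i k 0 = 1 := by
      simp [doubleDenom, qPoch, hc rfl]
    have hE₀ : ∀ p, E p = 0 ↔ p = 0 := fun p => by
      rw [hE, Prod.ext_iff]
      constructor <;> intro hp <;> simp_all
    refine hasSum_congr_of_eq (hasSum_zero_pow_mul hE₀ fun p => c p / doubleDenom 0 i k p)
      (fun p => mul_div_assoc _ _ _) ?_
    simp [hone, qPochInf₃, ha.ne', hb.ne', qPochInf_zero_left]
  · rw [← thetaFifteen_eq_qPochInf₃ hq0 hq hab]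
    exact h hq0

theorem hasSum_qPochInf₃_of_doubleSum {q : ℂ} (hq : ‖q‖ < 1) {E : ℕ × ℕ → ℕ} {A B i k a b : ℕ}
    (hE : ∀ p, E p = 4 * p.1 ^ 2 + 8 * p.1 * p.2 + 6 * p.2 ^ 2 + A * (p.1 + p.2) + B * p.2)
    (ha : 0 < a) (hb : 0 < b) (hab : a + b = 15)
    (h : q ≠ 0 → doubleSum q A B i k = thetaFifteen q a / qPochInf (q ^ 4) (q ^ 4)) :
    HasSum (fun p => q ^ E p / doubleDenom q i k p)
      (qPochInf₃ (q ^ a) (q ^ b) (q ^ 15) (q ^ 15) / qPochInf (q ^ 4) (q ^ 4)) := by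
  have hsum := hasSum_qPochInf₃_of_thetaFifteen hq (c := fun _ => 1) (i := i) (k := k) hE
    (fun _ => rfl) ha hb hab fun hq0 => by
      simpa only [mul_one, hE, h hq0] using hasSum_pow_div_doubleDenom hq0 hq A B i k
  simpa only [mul_one] using hsum

theorem qPoch_three_mul (a q : ℂ) (m : ℕ) : qPoch a q (3 * m) =
    qPoch a (q ^ 3) m * qPoch (a * q) (q ^ 3) m * qPoch (a * q ^ 2) (q ^ 3) m := by
  induction m with
  | zero => simp only [mul_zero, qPoch_zero, mul_one]
  | succ m ih =>
    rw [mul_add_one, qPoch_succ a q (3 * m + 2), qPoch_succ a q (3 * m + 1), qPoch_succ a q (3 * m),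
      qPoch_succ, qPoch_succ, qPoch_succ, ih]
    ring

theorem qPochInf_eq_qPochInf₃ (a : ℂ) {q : ℂ} (hq : ‖q‖ < 1) :
    qPochInf a q = qPochInf₃ a (a * q) (a * q ^ 2) (q ^ 3) := by
  have hq3 := norm_pow_lt_one hq three_ne_zero
  have htriple : Tendsto (fun m : ℕ => 3 * m) atTop atTop :=
    tendsto_id.const_mul_atTop' three_pos
  have hprod := ((tendsto_qPoch a hq3).mul (tendsto_qPoch (a * q) hq3)).mul
    (tendsto_qPoch (a * q ^ 2) hq3)
  exact tendsto_nhds_unique ((tendsto_qPoch a hq).comp htriple)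
    (hprod.congr fun m => (qPoch_three_mul a q m).symm)

theorem qPochInf_pow_five {q : ℂ} (hq : ‖q‖ < 1) :
    qPochInf (q ^ 5) (q ^ 5) = qPochInf₃ (q ^ 5) (q ^ 10) (q ^ 15) (q ^ 15) := by
  rw [qPochInf_eq_qPochInf₃ _ (norm_pow_lt_one hq (by norm_num))]
  simp only [← pow_mul, ← pow_add, Nat.reduceMul, Nat.reduceAdd]

/-! ### The seven identities -/

section Identities

variable {q : ℂ} (hq : ‖q‖ < 1)
include hq

theorem hasSum_theta_one :
    HasSum (fun p : ℕ × ℕ => q ^ (4 * p.1 ^ 2 + 8 * p.1 * p.2 + 6 * p.2 ^ 2 + 4 * p.1 + 6 * p.2) /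
        doubleDenom q 1 1 p)
      (qPochInf₃ q (q ^ 14) (q ^ 15) (q ^ 15) / qPochInf (q ^ 4) (q ^ 4)) := by
  simpa only [pow_one] using hasSum_qPochInf₃_of_doubleSum hq (A := 4) (B := 2) (a := 1) (b := 14)
    (fun p => by ring) (by norm_num) (by norm_num) rfl fun hq0 => doubleSum_eq_theta_one hq0 hq

theorem hasSum_theta_two :
    HasSum (fun p : ℕ × ℕ => q ^ (4 * p.1 ^ 2 + 8 * p.1 * p.2 + 6 * p.2 ^ 2 + 4 * p.1 + 6 * p.2) /
        doubleDenom q 1 0 p)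
      (qPochInf₃ (q ^ 2) (q ^ 13) (q ^ 15) (q ^ 15) / qPochInf (q ^ 4) (q ^ 4)) :=
  hasSum_qPochInf₃_of_doubleSum hq (A := 4) (B := 2) (a := 2) (b := 13)
    (fun p => by ring) (by norm_num) (by norm_num) rfl fun hq0 => doubleSum_eq_theta_two hq0 hq

theorem hasSum_theta_three :
    HasSum (fun p : ℕ × ℕ => q ^ (4 * p.1 ^ 2 + 8 * p.1 * p.2 + 6 * p.2 ^ 2 + 4 * p.1 + 6 * p.2) *
        (1 + q ^ (2 * p.2 + 1) + 2 * q ^ (2 * p.2 + 2) + q ^ (4 * p.2 + 3) +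
          q ^ (4 * p.1 + 4 * p.2 + 4)) / doubleDenom q 1 2 p)
      (qPochInf₃ (q ^ 3) (q ^ 12) (q ^ 15) (q ^ 15) / qPochInf (q ^ 4) (q ^ 4)) := by
  refine hasSum_qPochInf₃_of_thetaFifteen hq (A := 4) (B := 2) (fun p => by ring)
    (by rintro rfl; simp) three_pos (by norm_num) rfl fun hq0 => ?_
  have hS := hasSum_pow_div_doubleDenom hq0 hq
  have h := ((hS 4 2 1 2).add ((hS 4 4 1 2).mul_left (q + 2 * q ^ 2))).add
    ((hS 4 6 1 2).mul_left (q ^ 3)) |>.add ((hS 8 2 1 2).mul_left (q ^ 4))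
  exact hasSum_congr_of_eq h (fun p => by ring) (doubleSum_combination_eq_theta_three hq0 hq).symm

theorem hasSum_theta_four (hq0 : q ≠ 0) :
    HasSum (fun p : ℕ × ℕ =>
        q ^ (4 * (p.1 : ℤ) ^ 2 + 8 * (p.1 : ℤ) * (p.2 : ℤ) + 6 * (p.2 : ℤ) ^ 2 - 2) *
          (q ^ (4 * p.2) + q ^ (4 * p.2 + 2) + q ^ (6 * p.2 + 1) + q ^ (4 * p.1 + 6 * p.2 + 3) -
            1 - q ^ (2 * p.2 + 1)) / doubleDenom q 0 1 p)
      (qPochInf₃ (q ^ 4) (q ^ 11) (q ^ 15) (q ^ 15) / qPochInf (q ^ 4) (q ^ 4)) := by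
  have hS := hasSum_pow_div_doubleDenom hq0 hq
  have h := ((((hS 0 4 0 1).mul_left (1 + q ^ 2)).add ((hS 0 6 0 1).mul_left q)).add
    ((hS 4 2 0 1).mul_left (q ^ 3)) |>.sub (hS 0 0 0 1)).sub ((hS 0 2 0 1).mul_left q)
  refine hasSum_congr_of_eq (h.mul_left (q ^ 2)⁻¹) (fun p => ?_) ?_
  · rw [zpow_sub₀ hq0, zpow_ofNat]
    norm_cast
    ring
  · rw [← thetaFifteen_eq_qPochInf₃ hq0 hq (by rfl : 4 + 11 = 15), eq_inv_mul_iff_mul_eq₀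
      (pow_ne_zero 2 hq0)]
    exact (doubleSum_combination_eq_theta_four hq0 hq).symm

theorem hasSum_theta_five :
    HasSum (fun p : ℕ × ℕ => q ^ (4 * p.1 ^ 2 + 8 * p.1 * p.2 + 6 * p.2 ^ 2 + 2 * p.2) *
        (1 + q ^ (4 * p.1 + 2 * p.2 + 1)) / doubleDenom q 0 1 p)
      (qPochInf (q ^ 5) (q ^ 5) / qPochInf (q ^ 4) (q ^ 4)) := by
  rw [qPochInf_pow_five hq]
  refine hasSum_qPochInf₃_of_thetaFifteen hq (A := 0) (B := 2) (fun p => by ring)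
    (by rintro rfl; simp) (by norm_num) (by norm_num) rfl fun hq0 => ?_
  have hS := hasSum_pow_div_doubleDenom hq0 hq
  exact hasSum_congr_of_eq ((hS 0 2 0 1).add ((hS 4 0 0 1).mul_left q)) (fun p => by ring)
    (doubleSum_add_eq_theta_five hq0 hq).symm

theorem hasSum_theta_six :
    HasSum (fun p : ℕ × ℕ => q ^ (4 * p.1 ^ 2 + 8 * p.1 * p.2 + 6 * p.2 ^ 2 + 2 * p.2) /
        doubleDenom q 0 0 p)
      (qPochInf₃ (q ^ 6) (q ^ 9) (q ^ 15) (q ^ 15) / qPochInf (q ^ 4) (q ^ 4)) :=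
  hasSum_qPochInf₃_of_doubleSum hq (A := 0) (B := 2) (a := 6) (b := 9)
    (fun p => by ring) (by norm_num) (by norm_num) rfl fun hq0 => doubleSum_eq_theta_six hq0 hq

theorem hasSum_theta_seven :
    HasSum (fun p : ℕ × ℕ => q ^ (4 * p.1 ^ 2 + 8 * p.1 * p.2 + 6 * p.2 ^ 2) /
        doubleDenom q 0 0 p)
      (qPochInf₃ (q ^ 7) (q ^ 8) (q ^ 15) (q ^ 15) / qPochInf (q ^ 4) (q ^ 4)) :=
  hasSum_qPochInf₃_of_doubleSum hq (A := 0) (B := 0) (a := 7) (b := 8)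
    (fun p => by ring) (by norm_num) (by norm_num) rfl fun hq0 => doubleSum_eq_theta_seven hq0 hq

end Identities

theorem mainTheorem7 (q : ℂ) (hq : ‖q‖ < 1) :
    HasSum (fun p : ℕ × ℕ => let n := p.1; let r := p.2
        q ^ (4 * n ^ 2 + 8 * n * r + 6 * r ^ 2 + 4 * n + 6 * r) /
          (qPoch (-q ^ 2) (q ^ 2) (2 * n + 2 * r + 1) * qPoch (q ^ 2) (q ^ 2) r *
            qPoch (-q) q (2 * r + 1) * qPoch (q ^ 4) (q ^ 4) n))
      (qPochInf₃ q (q ^ 14) (q ^ 15) (q ^ 15) / qPochInf (q ^ 4) (q ^ 4)) ∧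
    HasSum (fun p : ℕ × ℕ => let n := p.1; let r := p.2
        q ^ (4 * n ^ 2 + 8 * n * r + 6 * r ^ 2 + 4 * n + 6 * r) /
          (qPoch (-q ^ 2) (q ^ 2) (2 * n + 2 * r + 1) * qPoch (q ^ 2) (q ^ 2) r *
            qPoch (-q) q (2 * r) * qPoch (q ^ 4) (q ^ 4) n))
      (qPochInf₃ (q ^ 2) (q ^ 13) (q ^ 15) (q ^ 15) / qPochInf (q ^ 4) (q ^ 4)) ∧
    HasSum (fun p : ℕ × ℕ => let n := p.1; let r := p.2
        q ^ (4 * n ^ 2 + 8 * n * r + 6 * r ^ 2 + 4 * n + 6 * r) *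
            (1 + q ^ (2 * r + 1) + 2 * q ^ (2 * r + 2) + q ^ (4 * r + 3) +
              q ^ (4 * n + 4 * r + 4)) /
          (qPoch (-q ^ 2) (q ^ 2) (2 * n + 2 * r + 1) * qPoch (q ^ 2) (q ^ 2) r *
            qPoch (-q) q (2 * r + 2) * qPoch (q ^ 4) (q ^ 4) n))
      (qPochInf₃ (q ^ 3) (q ^ 12) (q ^ 15) (q ^ 15) / qPochInf (q ^ 4) (q ^ 4)) ∧
    (q ≠ 0 →
      HasSum (fun p : ℕ × ℕ => let n := p.1; let r := p.2
          q ^ (4 * (n : ℤ) ^ 2 + 8 * (n : ℤ) * (r : ℤ) + 6 * (r : ℤ) ^ 2 - 2) *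
              (q ^ (4 * r) + q ^ (4 * r + 2) + q ^ (6 * r + 1) + q ^ (4 * n + 6 * r + 3) -
                1 - q ^ (2 * r + 1)) /
            (qPoch (-q ^ 2) (q ^ 2) (2 * n + 2 * r) * qPoch (q ^ 2) (q ^ 2) r *
              qPoch (-q) q (2 * r + 1) * qPoch (q ^ 4) (q ^ 4) n))
        (qPochInf₃ (q ^ 4) (q ^ 11) (q ^ 15) (q ^ 15) / qPochInf (q ^ 4) (q ^ 4))) ∧
    HasSum (fun p : ℕ × ℕ => let n := p.1; let r := p.2
        q ^ (4 * n ^ 2 + 8 * n * r + 6 * r ^ 2 + 2 * r) * (1 + q ^ (4 * n + 2 * r + 1)) /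
          (qPoch (-q ^ 2) (q ^ 2) (2 * n + 2 * r) * qPoch (q ^ 2) (q ^ 2) r *
            qPoch (-q) q (2 * r + 1) * qPoch (q ^ 4) (q ^ 4) n))
      (qPochInf (q ^ 5) (q ^ 5) / qPochInf (q ^ 4) (q ^ 4)) ∧
    HasSum (fun p : ℕ × ℕ => let n := p.1; let r := p.2
        q ^ (4 * n ^ 2 + 8 * n * r + 6 * r ^ 2 + 2 * r) /
          (qPoch (-q ^ 2) (q ^ 2) (2 * n + 2 * r) * qPoch (q ^ 2) (q ^ 2) r *
            qPoch (-q) q (2 * r) * qPoch (q ^ 4) (q ^ 4) n))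
      (qPochInf₃ (q ^ 6) (q ^ 9) (q ^ 15) (q ^ 15) / qPochInf (q ^ 4) (q ^ 4)) ∧
    HasSum (fun p : ℕ × ℕ => let n := p.1; let r := p.2
        q ^ (4 * n ^ 2 + 8 * n * r + 6 * r ^ 2) /
          (qPoch (-q ^ 2) (q ^ 2) (2 * n + 2 * r) * qPoch (q ^ 2) (q ^ 2) r *
            qPoch (-q) q (2 * r) * qPoch (q ^ 4) (q ^ 4) n))
      (qPochInf₃ (q ^ 7) (q ^ 8) (q ^ 15) (q ^ 15) / qPochInf (q ^ 4) (q ^ 4)) := by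
  exact ⟨hasSum_theta_one hq, hasSum_theta_two hq, hasSum_theta_three hq, hasSum_theta_four hq,
    hasSum_theta_five hq, hasSum_theta_six hq, hasSum_theta_seven hq⟩
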